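/- For a real Banach space $(Y,\|\cdot\|_Y)$ and $q\ge 2$, let $\mathfrak m_q(Y)\in[0,\infty]$ be the martingale cotype $q$ constant of $Y$, i.e. the supremum of $\big(\sum_{k=1}^\infty\int\|M_{k+1}-M_k\|_Y^q\,d\mu\big)^{1/q}$ over all probability spaces $(\mathscr S,\mathscr F,\mu)$ and all martingales $\{M_k\}_{k=1}^\infty\subset L_q(\mu;Y)$ with $\sup_k\int\|M_k\|_Y^q\,d\mu=1$ (a supremum over the empty set being $0$). Let $(X,\|\cdot\|_X)$ be a real normed space of finite dimension $n\ge 1$ with closed unit ball $B_X$, and let $|\cdot|$ be a Hilbertian norm on $X$ (one induced by an inner product), through which $X$ is identified with Euclidean space $\mathbb R^n$. Let $|\Omega|$ denote the Lebesgue measure of $\Omega\subset\mathbb R^n$ and $d\sigma$ the surface measure on the Euclidean unit sphere $S^{n-1}$, of total mass $|S^{n-1}|$. Put $$M(X)=\frac1{|S^{n-1}|}\int_{S^{n-1}}\|\sigma\|_X\,d\sigma,\qquad I_q(X)=\Big(\frac1{|B_X|}\int_{B_X}|x|^q\,dx\Big)^{1/q}.$$ For $t>0$ let $H_tf=h_t*f$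 with $h_t(x)=(4\pi t)^{-n/2}e^{-|x|^2/(4t)}$ be the heat semigroup on $\mathbb R^n$; let $T^1_x(g)(y)=g(x)+(y-x)\cdot\nabla g(x)$ be the first order Taylor polynomial of $g$ at $x$; and let $\|f\|_{\mathrm{Lip}(X,Y)}=\sup_{x\ne y}\|f(x)-f(y)\|_Y/\|x-y\|_X$. **Theorem 1.6.** There exists a universal constant $\kappa\in[2,\infty)$ with the following property. Let $q\in[2,\infty)$, let $n\ge 1$ be an integer, let $X$ be a real normed space with $\dim X=n$, let $Y$ be a real Banach space with $\mathfrak m_q(Y)<\infty$, and let $|\cdot|$ be any Hilbertian norm on $X$, identifying $X$ with $\mathbb R^n$. Set $$\gamma=\frac{I_q(X)}{\sqrt n\,M(X)},\qquad K=\kappa\, n^{1/4}\,\mathfrak m_q(Y)\sqrt{I_q(X)M(X)}.$$ Then every compactly supported $f:\mathbb R^n\to Y$ with $\|f\|_{\mathrm{Lip}(X,Y)}<\infty$ satisfies $$\bigg(\int_{\mathbb R^n}\int_0^\infty \frac1{|tB_X|}\int_{x+tB_X}\frac{\|f(y)-T^1_x(H_{\gamma t^2}f)(y)\|_Y^q}{t^{q+1}}\,dy\,dt\,dx\bigg)^{1/q}\le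 K\,|\mathrm{supp}(f)|^{1/q}\,\|f\|_{\mathrm{Lip}(X,Y)},$$ where $\mathrm{supp}(f)$ is the closed support of $f$. -/

import Mathlib

open MeasureTheory Set
open scoped ENNReal

noncomputable section

/-- The martingale cotype `q` constant of `Y`: the supremum of
`(∑ₖ ∫ ‖M (k+1) - M k‖ ^ q) ^ (1/q)` over all `Y`-valued martingales in `L_q` of a probability space
that are normalized by `supₖ ∫ ‖M k‖ ^ q = 1`. Restricting to probability spaces in `Type` loses
nothing, since the quantities depend only on the joint law of the sequence, which is carried by
a separable subspace of `Y`, hence can be realized on a standard Borel space. -/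
def martingaleCotype (q : ℝ) (Y : Type*) [NormedAddCommGroup Y] [NormedSpace ℝ Y]
    [CompleteSpace Y] : ℝ≥0∞ :=
  ⨆ (Ω : Type) (m0 : MeasurableSpace Ω) (μ : Measure Ω) (_ : IsProbabilityMeasure μ)
    (ℱ : Filtration ℕ m0) (M : ℕ → Ω → Y) (_ : Martingale M ℱ μ)
    (_ : ∀ k, MemLp (M k) (ENNReal.ofReal q) μ)
    (_ : (⨆ k, ∫⁻ ω, ‖M k ω‖ₑ ^ q ∂μ) = 1),
    (∑' k, ∫⁻ ω, ‖M (k + 1) ω - M k ω‖ₑ ^ q ∂μ) ^ (1 / q)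

/-- A function `N` on a real vector space is a Hilbertian norm if it is the norm induced by
a (positive definite) inner product. -/
def IsHilbertianNorm {X : Type*} [AddCommGroup X] [Module ℝ X] (N : X → ℝ) : Prop :=
  ∃ c : InnerProductSpace.Core ℝ X, ∀ x, N x = Real.sqrt (c.inner x x)

section geometry

variable {n : ℕ} {X : Type*} [NormedAddCommGroup X] [NormedSpace ℝ X]

/-! Throughout, `T` is the identification of `ℝⁿ` with `X`. The Euclidean norm of `x : ℝⁿ` is `‖x‖`,
and its norm as an element of `X` is `‖T x‖`. -/

/-- The ball `x + t B_X` of `X`, as a subset of `ℝⁿ`. -/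
def ballX (T : EuclideanSpace ℝ (Fin n) ≃ₗ[ℝ] X) (x : EuclideanSpace ℝ (Fin n)) (t : ℝ) :
    Set (EuclideanSpace ℝ (Fin n)) :=
  {y | ‖T (y - x)‖ ≤ t}

/-- `M(X)`: the average of `‖·‖_X` over the Euclidean unit sphere, with respect to
the surface measure. -/
def meanNorm (T : EuclideanSpace ℝ (Fin n) ≃ₗ[ℝ] X) : ℝ :=
  ⨍ σ : Metric.sphere (0 : EuclideanSpace ℝ (Fin n)) 1, ‖T (σ : EuclideanSpace ℝ (Fin n))‖
    ∂((volume : Measure (EuclideanSpace ℝ (Fin n))).toSphere)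

/-- `I_q(X)`: the `L_q` average of the Euclidean norm over the unit ball of `X`. -/
def meanRadius (q : ℝ) (T : EuclideanSpace ℝ (Fin n) ≃ₗ[ℝ] X) : ℝ :=
  (⨍ x in ballX T 0 1, ‖x‖ ^ q) ^ (1 / q)

/-- `γ(q, X) = I_q(X) / (√n M(X))`. -/
def gammaX (q : ℝ) (T : EuclideanSpace ℝ (Fin n) ≃ₗ[ℝ] X) : ℝ :=
  meanRadius q T / (Real.sqrt n * meanNorm T)

/-- `‖f‖_Lip(X, Y)`: the Lipschitz constant of `f : ℝⁿ → Y` with respect to the norm of `X`. -/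
def lipNorm {Y : Type*} [NormedAddCommGroup Y] (T : EuclideanSpace ℝ (Fin n) ≃ₗ[ℝ] X)
    (f : EuclideanSpace ℝ (Fin n) → Y) : ℝ≥0∞ :=
  ⨆ (x : EuclideanSpace ℝ (Fin n)) (y : EuclideanSpace ℝ (Fin n)) (_ : x ≠ y),
    ‖f x - f y‖ₑ / ‖T (x - y)‖ₑ

end geometry

/-- The heat kernel `h_t(x) = (4πt)^(-n/2) exp(-|x|²/(4t))` on `ℝⁿ`. -/
def heatKernel {n : ℕ} (t : ℝ) (x : EuclideanSpace ℝ (Fin n)) : ℝ :=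
  1 / (4 * Real.pi * t) ^ ((n : ℝ) / 2) * Real.exp (-‖x‖ ^ 2 / (4 * t))

/-- The heat semigroup `H_t f = h_t * f`. -/
def heat {n : ℕ} {Y : Type*} [NormedAddCommGroup Y] [NormedSpace ℝ Y] (t : ℝ)
    (f : EuclideanSpace ℝ (Fin n) → Y) (x : EuclideanSpace ℝ (Fin n)) : Y :=
  ∫ z, heatKernel t z • f (x - z)

/-- The first order Taylor polynomial of `g` at `x`, evaluated at `y`. -/
def taylorOne {n : ℕ} {Y : Type*} [NormedAddCommGroup Y] [NormedSpace ℝ Y]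
    (g : EuclideanSpace ℝ (Fin n) → Y) (x y : EuclideanSpace ℝ (Fin n)) : Y :=
  g x + fderiv ℝ g x (y - x)

end

/-! ### Martingale cotype as a homogeneous inequality for finite martingales. -/

section cotype

variable {q : ℝ} {Y : Type*} [NormedAddCommGroup Y] [NormedSpace ℝ Y] [CompleteSpace Y]

/-! Everything reduces to second differences of `f` along lines. In one variable, the slopes of `g`
over dyadic subintervals of `[0, 1]` form a martingale whose increments are, up to sign, `2 ^ k`
times second differences at midpoints. The slopes are bounded by a Lipschitz constant, so martingale
cotype bounds the sum over scales of the `q`-th powers of second differences. Applying this to `s ↦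
f (x + s R v)`, integrating in `x` and averaging `R` over an octave gives, with `B` bounding the
slopes along `v`, `∫∫ ‖f (x + r v) + f (x - r v) - 2 f x‖ ^ q dx dr / r ^ (q + 1) ≤ (4 m B) ^ q
|supp f|`, where `m` is the cotype constant (`lintegral_second_difference_le`).

Put `c = √(2γ)`, so that the heat flow at time `γ t ^ 2` averages `f` over displacements `c t g`
with `g` standard Gaussian. For `b` in the unit ball of `X`, the error at `x + t b` splits into two
pieces. The first, `f - H f`, is controlled by a Gaussian average of second differences along `c t
g`, and the mean `X`-length of `c g` is at most `c √n M`. The second is the Taylor remainder of `H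
f`, an integral of its second derivative in the direction `t b`. With both derivatives on the
kernel, this is a Gaussian average of `f` against `s ^ 2 - 1`, where `s` is the component along `e =
b / |b|`. Since this weight is even with mean zero, second differences along `c t s e` appear, with
prefactor `|b| ^ 2 / c ^ 2`. As `‖e‖_X ≤ 1 / |b|`, the total weight is `|b| / c` up to a
one-dimensional Gaussian moment, and its `L_q` average over the ball is `I_q / c`.

Minkowski's inequality (`lintegral_rpow_lintegral_le`) carries these averages through `L_q`. The
value of `γ` balances `c √n M` against `I_q / c`: both become multiples of `n ^ (1/4) √(I_q M)`. -/

theorem tsum_enorm_sub_rpow_le_of_normalized {Ω : Type} {m0 : MeasurableSpace Ω} {μ : Measure Ω}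
    [hμ : IsProbabilityMeasure μ] {ℱ : Filtration ℕ m0} {M : ℕ → Ω → Y} (hq : 0 < q)
    (hM : Martingale M ℱ μ) (hLp : ∀ k, MemLp (M k) (ENNReal.ofReal q) μ)
    (h1 : (⨆ k, ∫⁻ ω, ‖M k ω‖ₑ ^ q ∂μ) = 1) :
    ∑' k, ∫⁻ ω, ‖M (k + 1) ω - M k ω‖ₑ ^ q ∂μ ≤ martingaleCotype q Y ^ q := by
  have h : (∑' k, ∫⁻ ω, ‖M (k + 1) ω - M k ω‖ₑ ^ q ∂μ) ^ (1 / q) ≤ martingaleCotype q Y := by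
    unfold martingaleCotype
    exact le_iSup_of_le Ω <| le_iSup_of_le m0 <| le_iSup_of_le μ <| le_iSup_of_le hμ <|
      le_iSup_of_le ℱ <| le_iSup_of_le M <| le_iSup_of_le hM <| le_iSup_of_le hLp <|
      le_iSup_of_le h1 le_rfl
  rw [one_div] at h
  exact (ENNReal.rpow_inv_le_iff hq).1 h

theorem tsum_enorm_sub_rpow_le {Ω : Type} {m0 : MeasurableSpace Ω} {μ : Measure Ω}
    [hμ : IsProbabilityMeasure μ] {ℱ : Filtration ℕ m0} {M : ℕ → Ω → Y} (hq : 0 < q)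
    (hM : Martingale M ℱ μ) (hLp : ∀ k, MemLp (M k) (ENNReal.ofReal q) μ)
    (hfin : (⨆ k, ∫⁻ ω, ‖M k ω‖ₑ ^ q ∂μ) ≠ ∞) :
    ∑' k, ∫⁻ ω, ‖M (k + 1) ω - M k ω‖ₑ ^ q ∂μ
      ≤ martingaleCotype q Y ^ q * ⨆ k, ∫⁻ ω, ‖M k ω‖ₑ ^ q ∂μ := by
  set S := ⨆ k, ∫⁻ ω, ‖M k ω‖ₑ ^ q ∂μ with hS
  -- A null martingale cannot be normalized, so it is treated apart; otherwise `S ^ (-1/q)` rescales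
  -- the supremum to `1`.
  rcases eq_or_ne S 0 with h0 | h0
  · have hz : ∀ k, M k =ᵐ[μ] 0 := by
      intro k
      have h1 : ∫⁻ ω, ‖M k ω‖ₑ ^ q ∂μ = 0 :=
        le_antisymm (h0 ▸ le_iSup (fun k => ∫⁻ ω, ‖M k ω‖ₑ ^ q ∂μ) k) zero_le
      rw [lintegral_eq_zero_iff' ((hLp k).1.enorm.pow_const q)] at h1
      filter_upwards [h1] with ω hω
      simpa [ENNReal.rpow_eq_zero_iff, hq, hq.le, not_lt.2 hq.le] using hω
    have : ∑' k, ∫⁻ ω, ‖M (k + 1) ω - M k ω‖ₑ ^ q ∂μ = 0 := by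
      refine ENNReal.tsum_eq_zero.2 fun k => ?_
      rw [← lintegral_zero (μ := μ)]
      refine lintegral_congr_ae ?_
      filter_upwards [hz k, hz (k + 1)] with ω h1 h2
      simp [h1, h2, hq]
    simp [this]
  · set c : ℝ := (S.toReal) ^ (-1 / q) with hc
    have hSpos : 0 < S.toReal := ENNReal.toReal_pos h0 hfin
    have hcq : ‖c‖ₑ ^ q = S⁻¹ := by
      have hc0 : 0 ≤ c := Real.rpow_nonneg hSpos.le _
      rw [Real.enorm_eq_ofReal hc0, ENNReal.ofReal_rpow_of_nonneg hc0 hq.le, hc,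
        ← Real.rpow_mul hSpos.le, div_mul_cancel₀ _ hq.ne', Real.rpow_neg_one,
        ENNReal.ofReal_inv_of_pos hSpos, ENNReal.ofReal_toReal hfin]
    have hsc : ∀ y : Y, ‖c • y‖ₑ ^ q = S⁻¹ * ‖y‖ₑ ^ q := by
      intro y
      rw [enorm_smul, ENNReal.mul_rpow_of_nonneg _ _ hq.le, hcq]
    have hSi : S⁻¹ ≠ ∞ := ENNReal.inv_ne_top.2 h0
    have key := tsum_enorm_sub_rpow_le_of_normalized (q := q) (M := c • M) hq (hM.smul c)
      (fun k => (hLp k).const_smul c) (by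
        simp only [Pi.smul_apply, hsc]
        simp_rw [lintegral_const_mul' _ _ hSi]
        rw [← ENNReal.mul_iSup, ← hS, ENNReal.inv_mul_cancel h0 hfin])
    simp only [Pi.smul_apply, ← smul_sub, hsc] at key
    simp_rw [lintegral_const_mul' _ _ hSi] at key
    rw [ENNReal.tsum_mul_left, mul_comm, ← div_eq_mul_inv] at key
    exact ENNReal.div_le_iff h0 hfin |>.1 key

/-- Conditional expectation contracts `L_q`. For a martingale that stops moving, the supremum of the
norms is therefore the terminal one. -/
theorem lintegral_enorm_rpow_mono {Ω : Type} {m0 : MeasurableSpace Ω} {μ : Measure Ω}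
    {ℱ : Filtration ℕ m0} {M : ℕ → Ω → Y} (hq : 1 ≤ q)
    (hM : Martingale M ℱ μ) {k l : ℕ} (hkl : k ≤ l) :
    ∫⁻ ω, ‖M k ω‖ₑ ^ q ∂μ ≤ ∫⁻ ω, ‖M l ω‖ₑ ^ q ∂μ := by
  have hq0 : 0 < q := by linarith
  have h := eLpNorm_condExp_le_eLpNorm (μ := μ) (m := ℱ k) (M l) (p := ENNReal.ofReal q)
    (ENNReal.one_le_ofReal.2 hq)
  rw [eLpNorm_congr_ae (hM.condExp_ae_eq hkl),
    eLpNorm_eq_lintegral_rpow_enorm_toReal (by simpa) (by simp),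
    eLpNorm_eq_lintegral_rpow_enorm_toReal (by simpa) (by simp),
    ENNReal.toReal_ofReal hq0.le] at h
  exact (ENNReal.rpow_le_rpow_iff (by positivity)).1 h

/-- The martingale cotype inequality for a martingale that is constant after time `N`. -/
theorem sum_enorm_sub_rpow_le {Ω : Type} {m0 : MeasurableSpace Ω} {μ : Measure Ω}
    [IsProbabilityMeasure μ] {ℱ : Filtration ℕ m0} {M : ℕ → Ω → Y} (hq : 1 ≤ q)
    (hM : Martingale M ℱ μ) (hLp : ∀ k, MemLp (M k) (ENNReal.ofReal q) μ)
    (N : ℕ) (hN : ∀ k, N ≤ k → M k = M N) :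
    ∑ k ∈ Finset.range N, ∫⁻ ω, ‖M (k + 1) ω - M k ω‖ₑ ^ q ∂μ
      ≤ martingaleCotype q Y ^ q * ∫⁻ ω, ‖M N ω‖ₑ ^ q ∂μ := by
  have hq0 : 0 < q := by linarith
  have hS : (⨆ k, ∫⁻ ω, ‖M k ω‖ₑ ^ q ∂μ) = ∫⁻ ω, ‖M N ω‖ₑ ^ q ∂μ := by
    refine le_antisymm (iSup_le fun k => ?_) (le_iSup (fun k => ∫⁻ ω, ‖M k ω‖ₑ ^ q ∂μ) N)
    rcases le_total k N with h | h
    · exact lintegral_enorm_rpow_mono hq hM h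
    · rw [hN k h]
  have hfin : (⨆ k, ∫⁻ ω, ‖M k ω‖ₑ ^ q ∂μ) ≠ ∞ := by
    rw [hS]
    have h := (hLp N).2
    rw [eLpNorm_eq_lintegral_rpow_enorm_toReal (by simpa) (by simp),
      ENNReal.toReal_ofReal hq0.le] at h
    intro hcon
    rw [hcon] at h
    simp [hq0] at h
  exact (ENNReal.sum_le_tsum _).trans (hS ▸ tsum_enorm_sub_rpow_le hq0 hM hLp hfin)

end cotype

/-! ### Dyadic slopes of a function of one variable as a martingale on coin tosses. -/

section dyadic

/-- The uniform probability measure on `N` binary digits. -/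
noncomputable def coinMeasure (N : ℕ) : Measure (Fin N → Bool) :=
  (Measure.count (univ : Set (Fin N → Bool)))⁻¹ • Measure.count

instance (N : ℕ) : IsProbabilityMeasure (coinMeasure N) := by
  refine ⟨?_⟩
  rw [coinMeasure, Measure.smul_apply, smul_eq_mul]
  exact ENNReal.inv_mul_cancel (by simp) (by simp [Measure.count_apply])

/-- Keep the first `k` digits and set the others to zero. -/
def truncDigits {N : ℕ} (k : ℕ) (ω : Fin N → Bool) : Fin N → Bool :=
  fun i => if i.val < k then ω i else false

/-- The number in `[0, 1)` with given binary digits. -/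
noncomputable def binaryValue {N : ℕ} (ω : Fin N → Bool) : ℝ :=
  ∑ i, if ω i then (1 / 2 : ℝ) ^ (i.val + 1) else 0

/-- Change one digit. -/
def flipDigit {N : ℕ} (j : Fin N) (ω : Fin N → Bool) : Fin N → Bool :=
  Function.update ω j (!ω j)

theorem flipDigit_involutive {N : ℕ} (j : Fin N) : Function.Involutive (flipDigit j) := by
  intro ω
  simp [flipDigit]

theorem measurePreserving_flipDigit {N : ℕ} (j : Fin N) :
    MeasurePreserving (flipDigit j) (coinMeasure N) (coinMeasure N) := by
  refine ⟨measurable_of_finite _, ?_⟩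
  ext s hs
  rw [Measure.map_apply (measurable_of_finite _) hs, coinMeasure, Measure.smul_apply,
    Measure.smul_apply, Measure.count_apply (measurable_of_finite _ hs), Measure.count_apply hs]
  congr 2
  exact Set.encard_preimage_of_bijective (flipDigit_involutive j).bijective s

theorem truncDigits_truncDigits {N k l : ℕ} (h : k ≤ l) (ω : Fin N → Bool) :
    truncDigits k (truncDigits l ω) = truncDigits k ω := by
  funext i
  simp only [truncDigits]
  split_ifs <;> first | rfl | omega

theorem truncDigits_of_le {N k : ℕ} (h : N ≤ k) (ω : Fin N → Bool) : truncDigits k ω = ω := by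
  funext i
  simp [truncDigits, i.2.trans_le h]

theorem truncDigits_flipDigit {N : ℕ} (j : Fin N) (ω : Fin N → Bool) :
    truncDigits j (flipDigit j ω) = truncDigits j ω := by
  funext i
  simp only [truncDigits, flipDigit]
  split_ifs with h
  · rw [Function.update_of_ne]
    rintro rfl
    exact lt_irrefl _ h
  · rfl

theorem binaryValue_truncDigits_succ {N : ℕ} (j : Fin N) (ω : Fin N → Bool) :
    binaryValue (truncDigits (j + 1) ω) = binaryValue (truncDigits j ω) +
      if ω j then (1 / 2 : ℝ) ^ (j.val + 1) else 0 := by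
  unfold binaryValue
  rw [← Finset.add_sum_erase _ _ (Finset.mem_univ j),
    ← Finset.add_sum_erase (Finset.univ) (fun i : Fin N =>
      if truncDigits j ω i then (1 / 2 : ℝ) ^ (i.val + 1) else 0) (Finset.mem_univ j)]
  have h : ∀ i ∈ Finset.univ.erase j,
      (if truncDigits (j + 1) ω i then (1 / 2 : ℝ) ^ (i.val + 1) else 0)
        = if truncDigits j ω i then (1 / 2 : ℝ) ^ (i.val + 1) else 0 := by
    intro i hi
    have hij : i.val ≠ j.val := fun h => Finset.ne_of_mem_erase hi (Fin.ext h)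
    have : (i.val < j.val + 1) ↔ i.val < j.val := by omega
    simp [truncDigits, this]
  rw [Finset.sum_congr rfl h]
  simp [truncDigits]
  ring

/-- The filtration generated by the binary digits. -/
def digitFiltration (N : ℕ) :
    Filtration ℕ (MeasurableSpace.pi : MeasurableSpace (Fin N → Bool)) where
  seq k := MeasurableSpace.comap (truncDigits k) ⊤
  mono' := by
    intro k l hkl
    rintro s ⟨t, -, rfl⟩
    refine ⟨truncDigits k ⁻¹' t, trivial, ?_⟩
    ext ω
    simp [truncDigits_truncDigits hkl]
  le' := fun k s _ => .of_discrete

theorem integrable_of_coin {Y : Type*} [NormedAddCommGroup Y] {N : ℕ}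
    (F : (Fin N → Bool) → Y) : Integrable F (coinMeasure N) :=
  memLp_one_iff_integrable.1 .of_discrete

variable {q : ℝ} {Y : Type*} [NormedAddCommGroup Y] [NormedSpace ℝ Y]

/-- The slope of `g` on the dyadic interval of generation `min k N` that contains the point with
digits `ω`. -/
noncomputable def dyadicSlope {N : ℕ} (g : ℝ → Y) (k : ℕ) (ω : Fin N → Bool) : Y :=
  (2 ^ min k N : ℝ) • (g (binaryValue (truncDigits k ω) + (1 / 2) ^ min k N) -
    g (binaryValue (truncDigits k ω)))

theorem dyadicSlope_of_le {N : ℕ} (g : ℝ → Y) {k : ℕ} (h : N ≤ k) (ω : Fin N → Bool) :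
    dyadicSlope g k ω = dyadicSlope g N ω := by
  simp [dyadicSlope, truncDigits_of_le h, truncDigits_of_le le_rfl, h]

/-- The slope on an interval is the mean of the slopes on its two halves, so passing to either half
changes it by plus or minus the same midpoint second difference; the new digit decides the sign. -/
theorem dyadicSlope_succ_sub {N : ℕ} (g : ℝ → Y) (j : Fin N) (ω : Fin N → Bool) :
    dyadicSlope g (j + 1) ω - dyadicSlope g j ω = (if ω j then (1 : ℝ) else -1) • (2 ^ j.val : ℝ) •
      (g (binaryValue (truncDigits j ω) + (1 / 2) ^ j.val) + g (binaryValue (truncDigits j ω))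
        - (2 : ℝ) • g (binaryValue (truncDigits j ω) + (1 / 2) ^ (j.val + 1))) := by
  have h1 : min (j.val + 1) N = j.val + 1 := by omega
  have h2 : min j.val N = j.val := by omega
  simp only [dyadicSlope, h1, h2, binaryValue_truncDigits_succ]
  set a := binaryValue (truncDigits j ω)
  split_ifs with h
  · have : a + (1 / 2) ^ (j.val + 1) + (1 / 2) ^ (j.val + 1) = a + (1 / 2 : ℝ) ^ j.val := by ring
    rw [this]
    module
  · rw [add_zero]
    module

theorem stronglyMeasurable_dyadicSlope {N : ℕ} (g : ℝ → Y) (k : ℕ) :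
    StronglyMeasurable[digitFiltration N k] (dyadicSlope (N := N) g k) := by
  let F : (Fin N → Bool) → Y := fun ω => (2 ^ min k N : ℝ) •
    (g (binaryValue ω + (1 / 2) ^ min k N) - g (binaryValue ω))
  have h : StronglyMeasurable[⊤] F := by
    let _ : MeasurableSpace (Fin N → Bool) := ⊤
    exact StronglyMeasurable.of_discrete
  exact h.comp_measurable (comap_measurable _)

theorem martingale_dyadicSlope [CompleteSpace Y] (N : ℕ) (g : ℝ → Y) :
    Martingale (dyadicSlope (N := N) g) (digitFiltration N) (coinMeasure N) := by
  refine martingale_nat (stronglyMeasurable_dyadicSlope g) (fun k => integrable_of_coin _)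
    fun k => ?_
  rcases le_or_gt N k with h | h
  · have : dyadicSlope (N := N) g (k + 1) = dyadicSlope g k := by
      funext ω
      rw [dyadicSlope_of_le g (h.trans k.le_succ), dyadicSlope_of_le g h]
    rw [this, condExp_of_stronglyMeasurable _ (stronglyMeasurable_dyadicSlope g k)
      (integrable_of_coin _)]
  · refine ae_eq_condExp_of_forall_setIntegral_eq ((digitFiltration N).le k)
      (integrable_of_coin _) (fun _ _ _ => (integrable_of_coin _).integrableOn) ?_
      (stronglyMeasurable_dyadicSlope g k).aestronglyMeasurable
    rintro s hs -
    have hs' : MeasurableSet s := (digitFiltration N).le k s hs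
    rw [eq_comm, ← sub_eq_zero, ← integral_sub (integrable_of_coin _).integrableOn
      (integrable_of_coin _).integrableOn, ← integral_indicator hs']
    set d : (Fin N → Bool) → Y :=
      s.indicator fun ω => dyadicSlope g (k + 1) ω - dyadicSlope g k ω with hd
    let j : Fin N := ⟨k, h⟩
    -- Flipping the new digit preserves the measure and every event determined by the earlier
    -- digits, but negates the increment. Its integral over such an event is thus its own negative.
    have hflip : ∀ ω, d (flipDigit j ω) = - d ω := by
      intro ω
      obtain ⟨t, -, rfl⟩ := hs
      have hmem : flipDigit j ω ∈ truncDigits k ⁻¹' t ↔ ω ∈ truncDigits k ⁻¹' t := by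
        simp only [mem_preimage]
        rw [show k = j.val from rfl, truncDigits_flipDigit]
      by_cases hω : ω ∈ truncDigits k ⁻¹' t
      · rw [hd, indicator_of_mem (hmem.2 hω), indicator_of_mem hω,
          show k = j.val from rfl, dyadicSlope_succ_sub, dyadicSlope_succ_sub,
          truncDigits_flipDigit]
        have : flipDigit j ω j = !ω j := by simp [flipDigit]
        rw [this]
        cases ω j <;> simp
      · rw [hd, indicator_of_notMem (fun h => hω (hmem.1 h)), indicator_of_notMem hω, neg_zero]
    have h1 : ∫ ω, d ω ∂coinMeasure N = ∫ ω, d (flipDigit j ω) ∂coinMeasure N := by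
      have := integral_map (μ := coinMeasure N) (φ := flipDigit j)
        (measurable_of_finite _).aemeasurable (f := d) StronglyMeasurable.of_discrete.aestronglyMeasurable
      rwa [(measurePreserving_flipDigit j).map_eq] at this
    simp only [hflip, integral_neg] at h1
    have h2 : (2 : ℝ) • ∫ ω, d ω ∂coinMeasure N = 0 := by
      rw [two_smul]
      nth_rewrite 1 [h1]
      exact neg_add_cancel _
    exact (smul_eq_zero.1 h2).resolve_left two_ne_zero

/-- The cotype inequality for the dyadic martingale of slopes of a function of one variable. -/
theorem sum_dyadic_second_difference_le [CompleteSpace Y] (hq : 1 ≤ q) (N : ℕ) (g : ℝ → Y) :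
    ∑ k ∈ Finset.range N, ∫⁻ ω : Fin N → Bool, ‖(2 ^ k : ℝ) •
        (g (binaryValue (truncDigits k ω) + (1 / 2) ^ k) + g (binaryValue (truncDigits k ω))
          - (2 : ℝ) • g (binaryValue (truncDigits k ω) + (1 / 2) ^ (k + 1)))‖ₑ ^ q ∂coinMeasure N
      ≤ martingaleCotype q Y ^ q * ∫⁻ ω : Fin N → Bool, ‖(2 ^ N : ℝ) •
        (g (binaryValue ω + (1 / 2) ^ N) - g (binaryValue ω))‖ₑ ^ q ∂coinMeasure N := by
  have key := sum_enorm_sub_rpow_le hq (martingale_dyadicSlope N g) (fun _ => .of_discrete) N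
    (fun k hk => funext fun ω => dyadicSlope_of_le g hk ω)
  convert key using 1
  · refine Finset.sum_congr rfl fun k hk => ?_
    let j : Fin N := ⟨k, Finset.mem_range.1 hk⟩
    refine lintegral_congr fun ω => ?_
    rw [show k = j.val from rfl, dyadicSlope_succ_sub, enorm_smul (if ω j then (1 : ℝ) else -1)]
    have : ‖(if ω j then (1 : ℝ) else -1)‖ₑ = 1 := by split_ifs <;> simp
    rw [this, one_mul]
  · simp [dyadicSlope, truncDigits_of_le le_rfl]

end dyadic

/-! ### Changes of scale in Lebesgue integrals. -/

section scaling

theorem lintegral_comp_smul {V : Type*} [NormedAddCommGroup V] [NormedSpace ℝ V]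
    [FiniteDimensional ℝ V] [MeasurableSpace V] [BorelSpace V] (μ : Measure V)
    [μ.IsAddHaarMeasure] (F : V → ℝ≥0∞) {c : ℝ} (hc : 0 < c) :
    ∫⁻ x, F x ∂μ = ENNReal.ofReal (c ^ Module.finrank ℝ V) * ∫⁻ x, F (c • x) ∂μ := by
  have h := lintegral_map_equiv (μ := μ) F (Homeomorph.smulOfNeZero c hc.ne').toMeasurableEquiv
  simp only [Homeomorph.toMeasurableEquiv_coe, Homeomorph.smulOfNeZero_apply] at h
  rw [← h, Measure.map_addHaar_smul _ hc.ne', lintegral_smul_measure, smul_eq_mul, ← mul_assoc,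
    abs_of_pos (by positivity), ENNReal.ofReal_inv_of_pos (by positivity),
    ENNReal.mul_inv_cancel (by simpa using by positivity) (by simp), one_mul]

theorem setLIntegral_Ioc_comp_mul (F : ℝ → ℝ≥0∞) {c : ℝ} (hc : 0 < c) (a b : ℝ) :
    ∫⁻ r in Ioc (c * a) (c * b), F r = ENNReal.ofReal c * ∫⁻ r in Ioc a b, F (c * r) := by
  rw [← lintegral_indicator measurableSet_Ioc, ← lintegral_indicator measurableSet_Ioc,
    lintegral_comp_smul volume _ hc, Module.finrank_self, pow_one]
  congr 1
  refine lintegral_congr fun r => ?_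
  simp only [indicator, mem_Ioc, smul_eq_mul, mul_lt_mul_iff_right₀ hc, mul_le_mul_iff_right₀ hc]

end scaling

/-! ### The Dorronsoro inequality along a fixed direction. -/

section line

variable {n : ℕ} {q : ℝ} {Y : Type*} [NormedAddCommGroup Y] [NormedSpace ℝ Y]

local notation "E" => EuclideanSpace ℝ (Fin n)

theorem lintegral_coin_swap {N : ℕ} {F : (Fin N → Bool) → E → ℝ≥0∞}
    (hF : ∀ ω, Measurable (F ω)) :
    ∫⁻ x : E, (∫⁻ ω, F ω x ∂coinMeasure N) = ∫⁻ ω, (∫⁻ x : E, F ω x) ∂coinMeasure N := by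
  simp only [lintegral_fintype]
  rw [lintegral_finsetSum _ fun ω _ => (hF ω).mul_const _]
  refine Finset.sum_congr rfl fun ω _ => ?_
  rw [lintegral_mul_const _ (hF ω)]

/-- The increment vanishes off the union of the support and its translate by `-w`, whence the factor
2. -/
theorem lintegral_enorm_translate_sub_rpow_le {Y : Type*} [NormedAddCommGroup Y] (hq : 0 < q) (f : E → Y) (w : E) (c : ℝ≥0∞)
    (hc : ∀ x, ‖f (x + w) - f x‖ₑ ≤ c) :
    ∫⁻ x, ‖f (x + w) - f x‖ₑ ^ q ≤ c ^ q * (2 * volume (tsupport f)) := by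
  set S : Set E := (fun x => x + w) ⁻¹' tsupport f ∪ tsupport f with hS
  have hms : MeasurableSet (tsupport f) := (isClosed_tsupport f).measurableSet
  have hS' : MeasurableSet S := ((measurable_add_const w) hms).union hms
  have hle : ∀ x, ‖f (x + w) - f x‖ₑ ^ q ≤ S.indicator (fun _ => c ^ q) x := by
    intro x
    by_cases hx : x ∈ S
    · rw [indicator_of_mem hx]
      exact ENNReal.rpow_le_rpow (hc x) hq.le
    · have h1 : f (x + w) = 0 := image_eq_zero_of_notMem_tsupport fun h => hx (Or.inl h)
      have h2 : f x = 0 := image_eq_zero_of_notMem_tsupport fun h => hx (Or.inr h)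
      simp [h1, h2, hq]
  refine (lintegral_mono hle).trans ?_
  rw [lintegral_indicator hS', setLIntegral_const]
  gcongr
  refine (measure_union_le _ _).trans ?_
  rw [measure_preimage_add_right, two_mul]

theorem measurable_lintegral_second_difference {f : E → Y} (hf : Continuous f) (v : E) :
    Measurable fun r : ℝ => ∫⁻ x, ‖f (x + r • v) + f (x - r • v) - (2 : ℝ) • f x‖ₑ ^ q := by
  refine Measurable.lintegral_prod_right' (f := fun p : ℝ × E =>
    ‖f (p.2 + p.1 • v) + f (p.2 - p.1 • v) - (2 : ℝ) • f p.2‖ₑ ^ q) ?_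
  exact (Continuous.enorm (by fun_prop)).measurable.pow_const q

variable [CompleteSpace Y]

/-- This is the dyadic inequality for `s ↦ f (x + s R v)` integrated over `x`. Translation
invariance removes the random base point, so each scale contributes one deterministic integral. -/
theorem sum_lintegral_second_difference_le (hq : 1 ≤ q) {f : E → Y} (hf : Continuous f) (v : E)
    (B : ℝ≥0∞) (hB : ∀ x (r : ℝ), ‖f (x + r • v) - f x‖ₑ ≤ ‖r‖ₑ * B) {R : ℝ} (N : ℕ) :
    ∑ k ∈ Finset.range N, ENNReal.ofReal ((2 ^ k) ^ q) *
        ∫⁻ x, ‖f (x + (R * (1 / 2) ^ (k + 1)) • v) + f (x - (R * (1 / 2) ^ (k + 1)) • v)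
          - (2 : ℝ) • f x‖ₑ ^ q
      ≤ martingaleCotype q Y ^ q * ((‖R‖ₑ * B) ^ q * (2 * volume (tsupport f))) := by
  have hq0 : 0 < q := by linarith
  have hscal : ∀ (k : ℕ) (y : Y), ‖(2 ^ k : ℝ) • y‖ₑ ^ q = ENNReal.ofReal ((2 ^ k) ^ q) * ‖y‖ₑ ^ q := by
    intro k y
    rw [enorm_smul, ENNReal.mul_rpow_of_nonneg _ _ hq0.le, Real.enorm_eq_ofReal (by positivity),
      ENNReal.ofReal_rpow_of_nonneg (by positivity) hq0.le]
  have key := lintegral_mono (μ := (volume : Measure E)) fun x : E => sum_dyadic_second_difference_le hq N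
    (fun s => f (x + (s * R) • v))
  have hm : ∀ g : E → Y, Continuous g → Measurable fun x => ‖g x‖ₑ ^ q := fun g hg =>
    (hg.enorm.measurable).pow_const q
  rw [lintegral_finsetSum, lintegral_const_mul] at key
  rotate_left
  · simp only [lintegral_fintype]
    refine Finset.measurable_sum _ fun ω _ => Measurable.mul_const (hm _ (by fun_prop)) _
  · intro k _
    simp only [lintegral_fintype]
    refine Finset.measurable_sum _ fun ω _ => Measurable.mul_const (hm _ (by fun_prop)) _
  refine le_trans (le_of_eq ?_) (key.trans ?_)
  · refine Finset.sum_congr rfl fun k _ => ?_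
    rw [lintegral_coin_swap fun ω => hm _ (by fun_prop)]
    have : ∀ ω : Fin N → Bool, ∫⁻ x : E, ‖(2 ^ k : ℝ) •
        (f (x + ((binaryValue (truncDigits k ω) + (1 / 2) ^ k) * R) • v)
          + f (x + (binaryValue (truncDigits k ω) * R) • v)
          - (2 : ℝ) • f (x + ((binaryValue (truncDigits k ω) + (1 / 2) ^ (k + 1)) * R) • v))‖ₑ ^ q
        = ENNReal.ofReal ((2 ^ k) ^ q) *
        ∫⁻ x, ‖f (x + (R * (1 / 2) ^ (k + 1)) • v) + f (x - (R * (1 / 2) ^ (k + 1)) • v)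
          - (2 : ℝ) • f x‖ₑ ^ q := by
      intro ω
      simp only [hscal]
      rw [lintegral_const_mul _ (hm _ (by fun_prop))]
      congr 1
      -- Translate the midpoint of the dyadic interval to `x`, so that the second difference becomes
      -- symmetric.
      rw [← lintegral_add_right_eq_self _
        (-(((binaryValue (truncDigits k ω) + (1 / 2) ^ (k + 1)) * R) • v))]
      refine lintegral_congr fun x => ?_
      set a := binaryValue (truncDigits k ω)
      have e1 : x + -(((a + (1 / 2) ^ (k + 1)) * R) • v) + ((a + (1 / 2) ^ k) * R) • v
          = x + (R * (1 / 2) ^ (k + 1)) • v := by module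
      have e2 : x + -(((a + (1 / 2) ^ (k + 1)) * R) • v) + (a * R) • v
          = x - (R * (1 / 2) ^ (k + 1)) • v := by module
      rw [e1, e2, neg_add_cancel_right]
    simp only [this, lintegral_const, measure_univ, mul_one]
  · gcongr
    rw [lintegral_coin_swap fun ω => hm _ (by fun_prop)]
    refine (lintegral_mono (g := fun _ => (‖R‖ₑ * B) ^ q * (2 * volume (tsupport f)))
      fun ω => ?_).trans (by simp)
    simp only
    rw [← lintegral_add_right_eq_self _ (-(binaryValue ω * R) • v)]
    have := lintegral_enorm_translate_sub_rpow_le hq0 (f := fun x => (2 ^ N : ℝ) • f x)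
      ((((1 / 2) ^ N) * R) • v) (‖R‖ₑ * B) (by
        intro x
        rw [← smul_sub, enorm_smul]
        refine (mul_le_mul_right (hB _ _) _).trans (le_of_eq ?_)
        rw [enorm_mul, ← mul_assoc, ← mul_assoc, ← enorm_mul, ← mul_pow]
        norm_num)
    have hsupp : tsupport (fun x => (2 ^ N : ℝ) • f x) ⊆ tsupport f :=
      closure_mono (Function.support_const_smul_subset _ _)
    refine le_trans (le_of_eq ?_) (this.trans ?_)
    · refine lintegral_congr fun x => ?_
      rw [← smul_sub]
      congr 5
      · module
      · module
    · gcongr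

/-- Every scale in `(0, R]` is `r / 2 ^ (k + 1)` with `r` in the octave `(R, 2R]`. The integral thus
becomes an integral over `r` of the discrete sums bounded above, at a cost of at most `1 / R` per
unit of `r`. -/
theorem setLIntegral_Ioc_second_difference_le (hq : 1 ≤ q) {f : E → Y} (hf : Continuous f) (v : E)
    (B : ℝ≥0∞) (hB : ∀ x (r : ℝ), ‖f (x + r • v) - f x‖ₑ ≤ ‖r‖ₑ * B) {R : ℝ} (hR : 0 < R) :
    ∫⁻ r in Ioc 0 R, (∫⁻ x, ‖f (x + r • v) + f (x - r • v) - (2 : ℝ) • f x‖ₑ ^ q)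
        / ENNReal.ofReal (r ^ (q + 1))
      ≤ 4 ^ q * martingaleCotype q Y ^ q * B ^ q * volume (tsupport f) := by
  have hq0 : 0 < q := by linarith
  set D : ℝ → ℝ≥0∞ := fun r => ∫⁻ x, ‖f (x + r • v) + f (x - r • v) - (2 : ℝ) • f x‖ₑ ^ q with hD
  have hDm : Measurable D := measurable_lintegral_second_difference hf v
  have hcover : Ioc 0 R ⊆ ⋃ k : ℕ, Ioc ((1 / 2) ^ (k + 1) * R) ((1 / 2) ^ (k + 1) * (2 * R)) := by
    intro r hr
    obtain ⟨k, h1, h2⟩ := exists_nat_pow_near_of_lt_one (x := r / R) (y := (1 / 2 : ℝ))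
      (div_pos hr.1 hR) ((div_le_one hR).2 hr.2) (by norm_num) (by norm_num)
    refine mem_iUnion.2 ⟨k, (lt_div_iff₀ hR).1 h1, ((div_le_iff₀ hR).1 h2).trans (le_of_eq ?_)⟩
    ring
  refine (lintegral_mono_set hcover).trans ((lintegral_iUnion_le _ _).trans ?_)
  have hpiece : ∀ k : ℕ,
      ∫⁻ r in Ioc ((1 / 2) ^ (k + 1) * R) ((1 / 2) ^ (k + 1) * (2 * R)),
        D r / ENNReal.ofReal (r ^ (q + 1))
      = ∫⁻ r in Ioc R (2 * R), 2 ^ q * (ENNReal.ofReal ((2 ^ k) ^ q) *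
          D (r * (1 / 2) ^ (k + 1))) / ENNReal.ofReal (r ^ (q + 1)) := by
    intro k
    rw [setLIntegral_Ioc_comp_mul _ (by positivity), ← lintegral_const_mul]
    swap
    · exact (hDm.comp (by fun_prop)).div (by fun_prop)
    refine setLIntegral_congr_fun measurableSet_Ioc fun r hr => ?_
    have hr0 : 0 < r := hR.trans hr.1
    have hc : (0 : ℝ) < (1 / 2) ^ (k + 1) := by positivity
    rw [mul_comm r, Real.mul_rpow hc.le hr0.le, ENNReal.ofReal_mul (by positivity),
      div_eq_mul_inv, div_eq_mul_inv, ENNReal.mul_inv (by simp) (by simp)]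
    -- With `δ = 2 ^ (-(k + 1))`, the Jacobian `δ` and the weight `δ ^ (-(q + 1))` combine to `δ ^
    -- (-q)`, which is `2 ^ q` times the weight in the dyadic sum.
    have : ENNReal.ofReal ((1 / 2) ^ (k + 1)) * (ENNReal.ofReal (((1 / 2) ^ (k + 1)) ^ (q + 1)))⁻¹
        = 2 ^ q * ENNReal.ofReal ((2 ^ k) ^ q) := by
      rw [← ENNReal.ofReal_inv_of_pos (by positivity), ← ENNReal.ofReal_mul (by positivity),
        show (2 : ℝ≥0∞) = ENNReal.ofReal 2 by simp, ENNReal.ofReal_rpow_of_nonneg (by norm_num) hq0.le,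
        ← ENNReal.ofReal_mul (by positivity)]
      congr 1
      rw [Real.rpow_add_one hc.ne', mul_inv, mul_comm, mul_assoc, inv_mul_cancel₀ hc.ne', mul_one,
        ← Real.inv_rpow hc.le, ← Real.mul_rpow (by norm_num) (by positivity)]
      congr 1
      simp [pow_succ, mul_comm]
    rw [← mul_assoc (2 ^ q), ← this, div_eq_mul_inv]
    ring_nf
  change (∑' k : ℕ, ∫⁻ r in Ioc ((1 / 2) ^ (k + 1) * R) ((1 / 2) ^ (k + 1) * (2 * R)),
    D r / ENNReal.ofReal (r ^ (q + 1))) ≤ _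
  simp only [hpiece]
  rw [← lintegral_tsum]
  swap
  · intro k
    refine Measurable.aemeasurable ?_
    exact ((Measurable.const_mul (hDm.comp (by fun_prop)) _).const_mul _).div (by fun_prop)
  have hbound : ∀ r ∈ Ioc R (2 * R),
      (∑' k : ℕ, 2 ^ q * (ENNReal.ofReal ((2 ^ k) ^ q) *
          D (r * (1 / 2) ^ (k + 1))) / ENNReal.ofReal (r ^ (q + 1)))
      ≤ 4 ^ q * martingaleCotype q Y ^ q * B ^ q * volume (tsupport f) * ENNReal.ofReal R⁻¹ := by
    intro r hr
    have hr0 : 0 < r := hR.trans hr.1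
    simp only [div_eq_mul_inv]
    rw [ENNReal.tsum_mul_right, ENNReal.tsum_mul_left]
    have hsum : ∑' k : ℕ, (ENNReal.ofReal ((2 ^ k) ^ q) * D (r * (1 / 2) ^ (k + 1)))
        ≤ martingaleCotype q Y ^ q * ((‖r‖ₑ * B) ^ q * (2 * volume (tsupport f))) := by
      rw [ENNReal.tsum_eq_iSup_nat]
      exact iSup_le fun N => sum_lintegral_second_difference_le hq hf v B hB N
    -- One `2 ^ q` comes from the index shift `k + 1`, and the extra 2 from the two copies of the
    -- support.
    have h2 : (2 : ℝ≥0∞) ^ q * 2 ≤ 4 ^ q := by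
      calc (2 : ℝ≥0∞) ^ q * 2 ≤ 2 ^ q * 2 ^ q := by
            gcongr
            nth_rewrite 1 [← ENNReal.rpow_one 2]
            exact ENNReal.rpow_le_rpow_of_exponent_le (by norm_num) hq
        _ = 4 ^ q := by rw [← ENNReal.mul_rpow_of_nonneg _ _ hq0.le]; norm_num
    have h3 : ‖r‖ₑ ^ q * (ENNReal.ofReal (r ^ (q + 1)))⁻¹ ≤ ENNReal.ofReal R⁻¹ := by
      rw [Real.enorm_eq_ofReal hr0.le, ENNReal.ofReal_rpow_of_nonneg hr0.le hq0.le,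
        ← ENNReal.ofReal_inv_of_pos (by positivity), ← ENNReal.ofReal_mul (by positivity)]
      refine ENNReal.ofReal_le_ofReal ?_
      have : 0 < r ^ q := by positivity
      rw [Real.rpow_add_one hr0.ne', mul_inv, ← mul_assoc, mul_inv_cancel₀ this.ne', one_mul]
      exact inv_anti₀ hR hr.1.le
    calc 2 ^ q * (∑' k : ℕ, (ENNReal.ofReal ((2 ^ k) ^ q) * D (r * (1 / 2) ^ (k + 1))))
          * (ENNReal.ofReal (r ^ (q + 1)))⁻¹
        ≤ 2 ^ q * (martingaleCotype q Y ^ q * ((‖r‖ₑ * B) ^ q * (2 * volume (tsupport f))))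
          * (ENNReal.ofReal (r ^ (q + 1)))⁻¹ := by gcongr
      _ = (2 ^ q * 2) * martingaleCotype q Y ^ q * B ^ q * volume (tsupport f) *
          (‖r‖ₑ ^ q * (ENNReal.ofReal (r ^ (q + 1)))⁻¹) := by
        rw [ENNReal.mul_rpow_of_nonneg _ _ hq0.le]
        ring
      _ ≤ _ := by gcongr
  refine (setLIntegral_mono' measurableSet_Ioc hbound).trans ?_
  rw [setLIntegral_const, Real.volume_Ioc, mul_assoc, ← ENNReal.ofReal_mul (by positivity)]
  have : R⁻¹ * (2 * R - R) = 1 := by field_simp; ring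
  rw [this, ENNReal.ofReal_one, mul_one]

/-- The one-dimensional Dorronsoro inequality in the direction `v`. -/
theorem lintegral_second_difference_le (hq : 1 ≤ q) {f : E → Y} (hf : Continuous f) (v : E)
    (B : ℝ≥0∞) (hB : ∀ x (r : ℝ), ‖f (x + r • v) - f x‖ₑ ≤ ‖r‖ₑ * B) :
    ∫⁻ r in Ioi (0 : ℝ), (∫⁻ x, ‖f (x + r • v) + f (x - r • v) - (2 : ℝ) • f x‖ₑ ^ q)
        / ENNReal.ofReal (r ^ (q + 1))
      ≤ 4 ^ q * martingaleCotype q Y ^ q * B ^ q * volume (tsupport f) := by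
  -- The bound on `(0, R]` does not depend on `R`, so it survives the monotone limit.
  have hU : Ioi (0 : ℝ) = ⋃ j : ℕ, Ioc 0 (j : ℝ) := by
    ext r
    simp only [mem_Ioi, mem_iUnion, mem_Ioc]
    exact ⟨fun h => (exists_nat_ge r).imp fun j hj => ⟨h, hj⟩, fun ⟨_, h, _⟩ => h⟩
  rw [hU, setLIntegral_iUnion_of_directed]
  · refine iSup_le fun j => ?_
    rcases Nat.eq_zero_or_pos j with rfl | hj
    · simp
    · exact setLIntegral_Ioc_second_difference_le hq hf v B hB (by exact_mod_cast hj)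
  · exact directed_of_isDirected_le fun i j hij =>
      Ioc_subset_Ioc_right (by exact_mod_cast hij)

end line

/-! ### Minkowski's integral inequality by weighted Hölder. -/

section minkowski

variable {α β : Type*} {mα : MeasurableSpace α} {mβ : MeasurableSpace β}
  {μ : Measure α} {ν : Measure β} {q : ℝ}

/-- Hölder applied to `φ = (φ a ^ (-(q-1)/q)) · a ^ ((q-1)/q)`. With `a` comparable to the `L_q`
size of each slice, Tonelli then yields Minkowski with no loss. -/
theorem rpow_lintegral_le_of_weight {φ a : β → ℝ≥0∞} (hq : 1 < q) (hφ : Measurable φ)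
    (ha : Measurable a) (h0 : ∀ᵐ b ∂ν, a b ≠ 0) (hT : ∀ b, a b ≠ ∞) :
    (∫⁻ b, φ b ∂ν) ^ q ≤ (∫⁻ b, φ b ^ q * a b ^ (1 - q) ∂ν) * (∫⁻ b, a b ∂ν) ^ (q - 1) := by
  have hq0 : 0 < q := by linarith
  have hpq : q.HolderConjugate (q / (q - 1)) := Real.HolderConjugate.conjExponent hq
  have hp : 1 / (q / (q - 1)) = (q - 1) / q := one_div_div _ _
  have hp0 : 0 < (q - 1) / q := div_pos (by linarith) hq0
  have h1 : ∫⁻ b, φ b ∂ν = ∫⁻ b, ((fun b => φ b * a b ^ (-((q - 1) / q))) *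
      fun b => a b ^ ((q - 1) / q)) b ∂ν := by
    refine lintegral_congr_ae ?_
    filter_upwards [h0] with b hb
    simp only [Pi.mul_apply]
    rw [mul_assoc, ← ENNReal.rpow_add _ _ hb (hT b), neg_add_cancel, ENNReal.rpow_zero, mul_one]
  have h2 := ENNReal.lintegral_mul_le_Lp_mul_Lq ν hpq (f := fun b => φ b * a b ^ (-((q - 1) / q)))
    (g := fun b => a b ^ ((q - 1) / q)) (by fun_prop) (by fun_prop)
  rw [← h1, hp] at h2
  refine (ENNReal.rpow_le_rpow h2 hq0.le).trans (le_of_eq ?_)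
  rw [ENNReal.mul_rpow_of_nonneg _ _ hq0.le, ← ENNReal.rpow_mul, ← ENNReal.rpow_mul,
    one_div_mul_cancel hq0.ne', ENNReal.rpow_one, div_mul_cancel₀ _ hq0.ne']
  congr 1
  · refine lintegral_congr fun b => ?_
    rw [ENNReal.mul_rpow_of_nonneg _ _ hq0.le, ← ENNReal.rpow_mul]
    congr 2
    field_simp
    ring
  · congr 1
    refine lintegral_congr fun b => ?_
    rw [← ENNReal.rpow_mul, show (q - 1) / q * (q / (q - 1)) = 1 from ?_, ENNReal.rpow_one]
    have : q - 1 ≠ 0 := by linarith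
    field_simp

theorem lintegral_rpow_lintegral_le_of_ne_zero [SFinite μ] [SFinite ν] {φ : α → β → ℝ≥0∞}
    (hq : 1 < q) (hφ : Measurable (Function.uncurry φ)) {a : β → ℝ≥0∞} (ha : Measurable a)
    (h0 : ∀ᵐ b ∂ν, a b ≠ 0) (hT : ∀ b, a b ≠ ∞) (C : ℝ≥0∞)
    (h : ∀ b, ∫⁻ x, φ x b ^ q ∂μ ≤ C * a b ^ q) :
    ∫⁻ x, (∫⁻ b, φ x b ∂ν) ^ q ∂μ ≤ C * (∫⁻ b, a b ∂ν) ^ q := by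
  have hφ' : Measurable fun p : α × β => φ p.1 p.2 ^ q * a p.2 ^ (1 - q) :=
    (hφ.pow_const q).mul ((ha.comp measurable_snd).pow_const _)
  calc ∫⁻ x, (∫⁻ b, φ x b ∂ν) ^ q ∂μ
      ≤ ∫⁻ x, (∫⁻ b, φ x b ^ q * a b ^ (1 - q) ∂ν) * (∫⁻ b, a b ∂ν) ^ (q - 1) ∂μ :=
        lintegral_mono fun x => rpow_lintegral_le_of_weight hq hφ.of_uncurry_left ha h0 hT
    _ = (∫⁻ x, ∫⁻ b, φ x b ^ q * a b ^ (1 - q) ∂ν ∂μ) * (∫⁻ b, a b ∂ν) ^ (q - 1) :=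
        lintegral_mul_const _ hφ'.lintegral_prod_right'
    _ = (∫⁻ b, ∫⁻ x, φ x b ^ q * a b ^ (1 - q) ∂μ ∂ν) * (∫⁻ b, a b ∂ν) ^ (q - 1) := by
        rw [lintegral_lintegral_swap hφ'.aemeasurable]
    _ ≤ (∫⁻ b, C * a b ∂ν) * (∫⁻ b, a b ∂ν) ^ (q - 1) := by
        gcongr ?_ * _
        refine lintegral_mono_ae ?_
        filter_upwards [h0] with b hb
        rw [lintegral_mul_const _ (hφ.of_uncurry_right.pow_const q)]
        refine (mul_le_mul_left (h b) _).trans (le_of_eq ?_)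
        rw [mul_assoc, ← ENNReal.rpow_add _ _ hb (hT b), add_sub_cancel, ENNReal.rpow_one]
    _ = C * (∫⁻ b, a b ∂ν) ^ q := by
        rw [lintegral_const_mul _ ha, mul_assoc]
        congr 1
        nth_rewrite 1 [← ENNReal.rpow_one (∫⁻ b, a b ∂ν)]
        rw [← ENNReal.rpow_add_of_nonneg _ _ zero_le_one (by linarith), add_sub_cancel]

/-- A form of Minkowski's integral inequality. -/
theorem lintegral_rpow_lintegral_le [SFinite μ] [SFinite ν] {φ : α → β → ℝ≥0∞}
    (hq : 1 < q) (hφ : Measurable (Function.uncurry φ)) {a : β → ℝ≥0∞} (ha : Measurable a)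
    (hT : ∀ b, a b ≠ ∞) (C : ℝ≥0∞) (h : ∀ b, ∫⁻ x, φ x b ^ q ∂μ ≤ C * a b ^ q) :
    ∫⁻ x, (∫⁻ b, φ x b ∂ν) ^ q ∂μ ≤ C * (∫⁻ b, a b ∂ν) ^ q := by
  have hq0 : 0 < q := by linarith
  -- Negative powers of `a` are useless where `a = 0`; there the hypothesis forces the slice of `φ`
  -- to vanish almost everywhere, so this set is discarded.
  set Z : Set β := {b | a b = 0} with hZ
  have hZm : MeasurableSet Z := ha (measurableSet_singleton 0)
  have hnull : ∫⁻ x, ∫⁻ b in Z, φ x b ∂ν ∂μ = 0 := by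
    rw [lintegral_lintegral_swap hφ.aemeasurable]
    rw [setLIntegral_congr_fun (g := fun _ => 0) hZm, lintegral_zero]
    intro b hb
    have h1 := h b
    rw [show a b = 0 from hb, ENNReal.zero_rpow_of_pos hq0, mul_zero, nonpos_iff_eq_zero,
      lintegral_eq_zero_iff (hφ.of_uncurry_right.pow_const q)] at h1
    refine (lintegral_eq_zero_iff hφ.of_uncurry_right).2 ?_
    filter_upwards [h1] with x hx
    simpa [ENNReal.rpow_eq_zero_iff, hq0, not_lt.2 hq0.le] using hx
  have hnull' := (lintegral_eq_zero_iff (μ := μ)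
    (hφ.lintegral_prod_right' (ν := ν.restrict Z))).1 hnull
  have h1 : ∫⁻ x, (∫⁻ b, φ x b ∂ν) ^ q ∂μ = ∫⁻ x, (∫⁻ b in Zᶜ, φ x b ∂ν) ^ q ∂μ := by
    refine lintegral_congr_ae ?_
    filter_upwards [hnull'] with x hx
    rw [← lintegral_add_compl _ hZm]
    simp only [Pi.zero_apply, Function.uncurry] at hx
    rw [hx, zero_add]
  rw [h1]
  refine (lintegral_rpow_lintegral_le_of_ne_zero (ν := ν.restrict Zᶜ) hq hφ ha
    (ae_restrict_mem hZm.compl) hT C h).trans ?_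
  gcongr
  exact Measure.restrict_le_self

end minkowski

/-! ### Heat kernels as Gaussian laws. -/

section gaussian

open ProbabilityTheory

variable {n : ℕ}

local notation "E" => EuclideanSpace ℝ (Fin n)

theorem heatKernel_nonneg {t : ℝ} (ht : 0 < t) (x : E) : 0 ≤ heatKernel t x := by
  unfold heatKernel
  positivity

theorem continuous_heatKernel (t : ℝ) : Continuous (heatKernel t : E → ℝ) := by
  unfold heatKernel
  fun_prop

theorem heatKernel_cexp (t : ℝ) (x ξ : E) :
    (heatKernel t x : ℂ) * Complex.exp (inner ℝ x ξ * Complex.I) =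
      ((1 / (4 * Real.pi * t) ^ ((n : ℝ) / 2) : ℝ) : ℂ) *
        Complex.exp (-((1 / (4 * t) : ℝ) : ℂ) * ‖x‖ ^ 2 + Complex.I * inner ℝ ξ x) := by
  rw [heatKernel, Complex.ofReal_mul, mul_assoc, Complex.ofReal_exp, ← Complex.exp_add,
    real_inner_comm ξ x]
  congr 2
  push_cast
  field_simp

theorem integral_heatKernel_cexp {t : ℝ} (ht : 0 < t) (ξ : E) :
    ∫ x : E, (heatKernel t x : ℂ) * Complex.exp (inner ℝ x ξ * Complex.I) =
      Complex.exp (-t * ‖ξ‖ ^ 2) := by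
  simp_rw [heatKernel_cexp t]
  rw [integral_const_mul, GaussianFourier.integral_cexp_neg_mul_sq_norm_add
    (by rw [Complex.ofReal_re]; positivity), ← mul_assoc]
  have h1 : (Real.pi / ((1 / (4 * t) : ℝ) : ℂ)) ^ ((Module.finrank ℝ E : ℂ) / 2)
      = (((4 * Real.pi * t) ^ ((n : ℝ) / 2) : ℝ) : ℂ) := by
    rw [finrank_euclideanSpace_fin, Complex.ofReal_cpow (by positivity)]
    push_cast
    congr 1
    field_simp
  rw [h1, ← Complex.ofReal_mul, one_div_mul_cancel (by positivity), Complex.ofReal_one, one_mul]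
  congr 1
  push_cast
  rw [Complex.I_sq]
  have : (t : ℂ) ≠ 0 := by exact_mod_cast ht.ne'
  field_simp

theorem integrable_heatKernel {t : ℝ} (ht : 0 < t) : Integrable (heatKernel t : E → ℝ) := by
  have h := GaussianFourier.integrable_cexp_neg_mul_sq_norm_add (V := E) (b := ((1 / (4 * t) : ℝ) : ℂ))
    (by rw [Complex.ofReal_re]; positivity) 0 0
  have h2 : Integrable fun x : E => (heatKernel t x : ℂ) := by
    refine (h.const_mul ((1 / (4 * Real.pi * t) ^ ((n : ℝ) / 2) : ℝ) : ℂ)).congr ?_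
    refine Filter.Eventually.of_forall fun x => ?_
    have := heatKernel_cexp t x 0
    simpa using this.symm
  exact h2.re

/-- Both finite measures have characteristic function `exp (-t |ξ| ^ 2)`. -/
theorem map_smul_stdGaussian {t : ℝ} (ht : 0 < t) :
    (stdGaussian E).map (fun g => √(2 * t) • g) =
      volume.withDensity fun z : E => ENNReal.ofReal (heatKernel t z) := by
  have hfin : IsFiniteMeasure (volume.withDensity fun z : E => ENNReal.ofReal (heatKernel t z)) :=
    isFiniteMeasure_withDensity_ofReal (integrable_heatKernel ht).2
  refine Measure.ext_of_charFun (funext fun ξ => ?_)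
  rw [charFun_map_smul, charFun_stdGaussian, charFun_apply,
    integral_withDensity_eq_integral_toReal_smul
      (continuous_heatKernel t).measurable.ennreal_ofReal (by simp)]
  have : ∀ x : E, (ENNReal.ofReal (heatKernel t x)).toReal • Complex.exp (inner ℝ x ξ * Complex.I)
      = (heatKernel t x : ℂ) * Complex.exp (inner ℝ x ξ * Complex.I) := by
    intro x
    rw [ENNReal.toReal_ofReal (heatKernel_nonneg ht x), Complex.real_smul]
  simp_rw [this]
  rw [integral_heatKernel_cexp ht, norm_smul, Real.norm_of_nonneg (by positivity)]
  congr 1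
  push_cast
  rw [mul_pow, ← Complex.ofReal_pow (√(2 * t)), Real.sq_sqrt (by positivity)]
  push_cast
  ring

theorem integral_heatKernel_smul {Y : Type*} [NormedAddCommGroup Y] [NormedSpace ℝ Y]
    {t : ℝ} (ht : 0 < t) (F : E → Y) :
    ∫ z, heatKernel t z • F z = ∫ g, F (√(2 * t) • g) ∂stdGaussian E := by
  have hne : √(2 * t) ≠ 0 := by positivity
  have h1 := (Homeomorph.smulOfNeZero (α := E) _ hne).measurableEmbedding.integral_map
    (μ := stdGaussian E) F
  simp only [Homeomorph.smulOfNeZero_apply] at h1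
  rw [← h1]
  change _ = ∫ y, F y ∂(stdGaussian E).map (fun g => √(2 * t) • g)
  rw [map_smul_stdGaussian ht, integral_withDensity_eq_integral_toReal_smul
      (continuous_heatKernel t).measurable.ennreal_ofReal (by simp)]
  simp_rw [ENNReal.toReal_ofReal (heatKernel_nonneg ht _)]

theorem stdGaussian_eq_withDensity :
    stdGaussian E = volume.withDensity fun z : E => ENNReal.ofReal (heatKernel (1 / 2) z) := by
  rw [← map_smul_stdGaussian (by norm_num)]
  simp

theorem map_neg_stdGaussian : (stdGaussian E).map (fun g => -g) = stdGaussian E := by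
  have : IsFiniteMeasure ((stdGaussian E).map (fun g => -g)) := Measure.isFiniteMeasure_map _ _
  refine Measure.ext_of_charFun (funext fun ξ => ?_)
  have h := charFun_map_smul (μ := stdGaussian E) (-1) ξ
  simp only [neg_smul, one_smul] at h
  rw [h, charFun_stdGaussian, charFun_stdGaussian, norm_neg]

/-- The standard Gaussian measure is invariant under resampling the component in the direction of a
unit vector. -/
theorem map_resample_stdGaussian {e : E} (he : ‖e‖ = 1) :
    ((stdGaussian E).prod (gaussianReal 0 1)).map
      (fun p : E × ℝ => p.1 - inner ℝ e p.1 • e + p.2 • e) = stdGaussian E := by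
  have hm : Measurable fun p : E × ℝ => p.1 - inner ℝ e p.1 • e + p.2 • e :=
    Continuous.measurable (by fun_prop)
  have : IsFiniteMeasure (((stdGaussian E).prod (gaussianReal 0 1)).map
      (fun p : E × ℝ => p.1 - inner ℝ e p.1 • e + p.2 • e)) := Measure.isFiniteMeasure_map _ _
  refine Measure.ext_of_charFun (funext fun ξ => ?_)
  have hint : ∀ p : E × ℝ, Complex.exp (inner ℝ (p.1 - inner ℝ e p.1 • e + p.2 • e) ξ * Complex.I)
      = Complex.exp (inner ℝ p.1 (ξ - inner ℝ e ξ • e) * Complex.I) *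
        Complex.exp (inner ℝ p.2 (inner ℝ e ξ : ℝ) * Complex.I) := by
    intro p
    rw [← Complex.exp_add]
    congr 1
    rw [← add_mul, ← Complex.ofReal_add]
    congr 2
    simp only [inner_add_left, inner_sub_left, inner_sub_right, inner_smul_left, inner_smul_right,
      real_inner_comm p.1 e]
    simp
    ring
  rw [charFun_apply, integral_map hm.aemeasurable
    (Continuous.aestronglyMeasurable (by fun_prop))]
  simp_rw [hint]
  rw [integral_prod_mul (fun x : E => Complex.exp (inner ℝ x (ξ - inner ℝ e ξ • e) * Complex.I))
    (fun s : ℝ => Complex.exp (inner ℝ s (inner ℝ e ξ : ℝ) * Complex.I)),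
    ← charFun_apply, ← charFun_apply, charFun_stdGaussian, charFun_stdGaussian,
    charFun_gaussianReal, ← Complex.exp_add]
  congr 1
  -- By Pythagoras, the exponents from the orthogonal part and from the fresh coordinate add up to
  -- that of `ξ`.
  have h2 : ‖ξ - inner ℝ e ξ • e‖ ^ 2 = ‖ξ‖ ^ 2 - (inner ℝ e ξ) ^ 2 := by
    rw [norm_sub_sq_real, norm_smul, he, inner_smul_right, real_inner_comm e ξ, mul_one,
      Real.norm_eq_abs, sq_abs]
    ring
  rw [← Complex.ofReal_pow, h2]
  push_cast
  ring

theorem integral_norm_sq_stdGaussian : ∫ g, ‖g‖ ^ 2 ∂stdGaussian E = n := by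
  have hm : ∀ L : E →L[ℝ] ℝ, MemLp L 2 (stdGaussian E) := fun L =>
    L.comp_memLp' (IsGaussian.memLp_id (stdGaussian E) 2 (by simp))
  have h2 : ∀ i : Fin n, Integrable (fun g : E => g i ^ 2) (stdGaussian E) := fun i =>
    (hm (EuclideanSpace.proj i)).integrable_sq
  simp_rw [EuclideanSpace.norm_sq_eq, Real.norm_eq_abs, sq_abs]
  rw [integral_finsetSum _ fun i _ => h2 i]
  have : ∀ i : Fin n, ∫ g : E, g i ^ 2 ∂stdGaussian E = 1 := by
    intro i
    have hv := variance_dual_stdGaussian (innerSL ℝ (EuclideanSpace.single i (1 : ℝ)))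
    rw [variance_eq_sub (hm _), integral_strongDual_stdGaussian] at hv
    simpa [EuclideanSpace.inner_single_left] using hv
  simp [this]

theorem lintegral_enorm_stdGaussian_le :
    ∫⁻ g, ‖g‖ₑ ∂stdGaussian E ≤ ENNReal.ofReal (√n) := by
  have h2 : Integrable (fun g : E => ‖g‖ ^ 2) (stdGaussian E) :=
    (IsGaussian.memLp_id (stdGaussian E) 2 (by simp)).norm.integrable_sq
  have h1 : Integrable (fun g : E => ‖g‖) (stdGaussian E) :=
    (memLp_one_iff_integrable.1 (IsGaussian.memLp_id (stdGaussian E) 1 (by simp))).norm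
  have h3 : ∫⁻ g, ‖g‖ₑ ∂stdGaussian E = ENNReal.ofReal (∫ g, ‖g‖ ∂stdGaussian E) := by
    rw [ofReal_integral_eq_lintegral_ofReal h1 (by filter_upwards with x using norm_nonneg x)]
    simp
  rw [h3]
  refine ENNReal.ofReal_le_ofReal (Real.le_sqrt_of_sq_le ?_)
  have hv := variance_nonneg (fun g : E => ‖g‖) (stdGaussian E)
  rw [variance_eq_sub (X := fun g : E => ‖g‖)
    (IsGaussian.memLp_id (stdGaussian E) 2 (by simp)).norm] at hv
  simp only [Pi.pow_apply] at hv
  rw [integral_norm_sq_stdGaussian] at hv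
  linarith

end gaussian

/-! ### Polar coordinates and the Gaussian mean of the norm of `X`. -/

section polar

variable {n : ℕ} {X : Type*} [NormedAddCommGroup X] [NormedSpace ℝ X]

local notation "E" => EuclideanSpace ℝ (Fin n)

theorem lintegral_radial_mul (hn : 1 ≤ n) (k : ℝ → ℝ≥0∞) (hk : Measurable k)
    (T : E →ₗ[ℝ] X) :
    ∫⁻ z : E, k ‖z‖ * ‖T z‖ₑ =
      (∫⁻ σ : Metric.sphere (0 : E) 1, ‖T σ‖ₑ ∂(volume : Measure E).toSphere) *
        ∫⁻ r : Ioi (0 : ℝ), k r * ENNReal.ofReal r ∂Measure.volumeIoiPow (n - 1) := by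
  have hT : Continuous T := T.continuous_of_finiteDimensional
  have : Nonempty (Fin n) := ⟨⟨0, hn⟩⟩
  have hmp := (volume : Measure E).measurePreserving_homeomorphUnitSphereProd
  rw [finrank_euclideanSpace_fin] at hmp
  rw [← lintegral_prod_mul (by exact (Continuous.measurable (by fun_prop)).aemeasurable)
    (by fun_prop), ← hmp.lintegral_comp]
  swap
  · refine Measurable.mul ?_ ?_
    · exact Continuous.measurable (by fun_prop)
    · fun_prop
  rw [← setLIntegral_univ, ← setLIntegral_univ (μ := Measure.comap _ _)]
  have h1 : ∀ x : ({0}ᶜ : Set E),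
      ‖T ((homeomorphUnitSphereProd E) x).1‖ₑ *
        (k ((homeomorphUnitSphereProd E) x).2 * ENNReal.ofReal ((homeomorphUnitSphereProd E) x).2)
      = k ‖(x : E)‖ * ‖T x‖ₑ := by
    intro x
    have hx : (x : E) ≠ 0 := x.2
    have hx' : ‖(x : E)‖ ≠ 0 := norm_ne_zero_iff.2 hx
    simp only [homeomorphUnitSphereProd_apply_snd_coe, homeomorphUnitSphereProd_apply_fst_coe]
    rw [map_smul, enorm_smul, ← Real.enorm_eq_ofReal (norm_nonneg _), mul_comm, mul_assoc,
      ← mul_assoc ‖‖(x : E)‖‖ₑ, ← enorm_mul, mul_inv_cancel₀ hx', enorm_one, one_mul]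
  simp_rw [h1]
  rw [setLIntegral_subtype (measurableSet_singleton _).compl univ fun x : E => k ‖x‖ * ‖T x‖ₑ,
    image_univ, Subtype.range_coe, setLIntegral_univ]
  rw [restrict_compl_singleton]

theorem lintegral_enorm_sphere (hn : 1 ≤ n) (T : E ≃ₗ[ℝ] X) :
    ∫⁻ σ : Metric.sphere (0 : E) 1, ‖T σ‖ₑ ∂(volume : Measure E).toSphere =
      ENNReal.ofReal (meanNorm T) * (volume : Measure E).toSphere univ := by
  have : Nonempty (Fin n) := ⟨⟨0, hn⟩⟩
  have hT : Continuous T := T.toLinearMap.continuous_of_finiteDimensional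
  have hc : Continuous fun σ : Metric.sphere (0 : E) 1 => ‖T σ‖ := by fun_prop
  have hint : Integrable (fun σ : Metric.sphere (0 : E) 1 => ‖T σ‖)
      (volume : Measure E).toSphere := hc.integrable_of_hasCompactSupport (.of_compactSpace _)
  have h1 : ∫⁻ σ : Metric.sphere (0 : E) 1, ‖T σ‖ₑ ∂(volume : Measure E).toSphere =
      ENNReal.ofReal (∫ σ : Metric.sphere (0 : E) 1, ‖T σ‖ ∂(volume : Measure E).toSphere) := by
    rw [ofReal_integral_eq_lintegral_ofReal hint (by filter_upwards with x using norm_nonneg _)]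
    simp
  rw [h1, meanNorm, average_eq, smul_eq_mul, ← ofReal_measureReal,
    ← ENNReal.ofReal_mul' measureReal_nonneg]
  congr 1
  have : (volume : Measure E).toSphere.real univ ≠ 0 := by
    rw [measureReal_ne_zero_iff, Measure.measure_univ_ne_zero]
    exact Measure.toSphere_ne_zero _
  field_simp

theorem meanNorm_nonneg (T : E ≃ₗ[ℝ] X) : 0 ≤ meanNorm T :=
  integral_nonneg fun _ => norm_nonneg _

/-- By homogeneity the radial factor is the same for the norm of `X` and the Euclidean norm, so the
mean of `‖T g‖` is `M(X)` times the mean of `|g|`, which is at most `√n`. -/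
theorem lintegral_enorm_map_stdGaussian_le (hn : 1 ≤ n) (T : E ≃ₗ[ℝ] X) :
    ∫⁻ g, ‖T g‖ₑ ∂ProbabilityTheory.stdGaussian E ≤ ENNReal.ofReal (meanNorm T * √n) := by
  have hT : Continuous T := T.toLinearMap.continuous_of_finiteDimensional
  let k : ℝ → ℝ≥0∞ := fun r => ENNReal.ofReal
    (1 / (4 * Real.pi * (1 / 2)) ^ ((n : ℝ) / 2) * Real.exp (-r ^ 2 / (4 * (1 / 2))))
  have hk : Measurable k := by fun_prop
  have hd : ∀ F : E → ℝ≥0∞, Measurable F → ∫⁻ g, F g ∂ProbabilityTheory.stdGaussian E =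
      ∫⁻ z : E, k ‖z‖ * F z := by
    intro F hF
    rw [stdGaussian_eq_withDensity, lintegral_withDensity_eq_lintegral_mul _
      (continuous_heatKernel _).measurable.ennreal_ofReal hF]
    rfl
  have h1 := hd (fun g => ‖T g‖ₑ) hT.enorm.measurable
  have h2 := hd (fun g => ‖g‖ₑ) (by fun_prop)
  have e1 := lintegral_radial_mul hn k hk T.toLinearMap
  have e2 := lintegral_radial_mul hn k hk (LinearMap.id : E →ₗ[ℝ] E)
  simp only [LinearEquiv.coe_coe, LinearMap.id_coe, id] at e1 e2
  rw [lintegral_enorm_sphere hn] at e1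
  have hs : ∀ σ : Metric.sphere (0 : E) 1, ‖(σ : E)‖ₑ = 1 := fun σ => by
    rw [← ofReal_norm, norm_eq_of_mem_sphere, ENNReal.ofReal_one]
  simp only [hs, lintegral_const, one_mul] at e2
  rw [h1, e1, mul_assoc, ← e2, ← h2, ENNReal.ofReal_mul (meanNorm_nonneg T)]
  gcongr
  exact lintegral_enorm_stdGaussian_le

theorem meanNorm_pos (hn : 1 ≤ n) (T : E ≃ₗ[ℝ] X) : 0 < meanNorm T := by
  refine (meanNorm_nonneg T).lt_of_ne' fun h0 => ?_
  have : Nonempty (Fin n) := ⟨⟨0, hn⟩⟩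
  have hT : Continuous T := T.toLinearMap.continuous_of_finiteDimensional
  have h := lintegral_enorm_sphere hn T
  rw [h0, ENNReal.ofReal_zero, zero_mul, lintegral_eq_zero_iff
    (Continuous.measurable (by fun_prop))] at h
  refine Measure.toSphere_ne_zero (volume : Measure E) (Measure.measure_univ_eq_zero.1 ?_)
  refine measure_mono_null (fun σ _ => ?_) h
  simp only [mem_compl_iff, mem_ofPred_eq, Pi.zero_apply, enorm_eq_zero,
    EmbeddingLike.map_eq_zero_iff]
  exact ne_zero_of_mem_unit_sphere σ

end polar

/-! ### Derivatives of the heat flow and its Taylor remainder. -/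

section kernel

variable {n : ℕ} {Y : Type*} [NormedAddCommGroup Y] [NormedSpace ℝ Y]

local notation "E" => EuclideanSpace ℝ (Fin n)

theorem hasFDerivAt_integral_kernel {k : E → ℝ} (hk : ContDiff ℝ 1 k) {f : E → Y}
    (hf : Continuous f) (hs : HasCompactSupport f) (x : E) :
    HasFDerivAt (fun x => ∫ z, k (x - z) • f z)
      (∫ z, (fderiv ℝ k (x - z)).smulRight (f z)) x := by
  have hkc : Continuous k := hk.continuous
  have hk' : Continuous (fderiv ℝ k) := hk.continuous_fderiv one_ne_zero
  -- The kernel need not have compact support, but `f` does: a bound on its derivative over a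
  -- compact set suffices for domination.
  obtain ⟨C, hC⟩ := ((isCompact_closedBall x 1).prod hs.isCompact).exists_bound_of_continuousOn
    (f := fun p : E × E => fderiv ℝ k (p.1 - p.2)) (Continuous.continuousOn (by fun_prop))
  have hint : ∀ x, Integrable fun z => k (x - z) • f z := fun x =>
    Continuous.integrable_of_hasCompactSupport (by fun_prop) hs.smul_left
  refine hasFDerivAt_integral_of_dominated_of_fderiv_le (bound := fun z => |C| * ‖f z‖)
    (s := Metric.closedBall x 1) (Metric.closedBall_mem_nhds x one_pos)
    (.of_forall fun x => (hint x).aestronglyMeasurable) (hint x)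
    (F' := fun x z => (fderiv ℝ k (x - z)).smulRight (f z)) ?_ ?_ ?_ ?_
  · exact Continuous.aestronglyMeasurable (by fun_prop)
  · refine .of_forall fun z y hy => ?_
    rw [ContinuousLinearMap.norm_smulRight_apply]
    by_cases hz : z ∈ tsupport f
    · gcongr
      exact (hC (y, z) ⟨hy, hz⟩).trans (le_abs_self C)
    · simp [image_eq_zero_of_notMem_tsupport hz]
  · exact ((hf.integrable_of_hasCompactSupport hs).norm).const_mul _
  · refine .of_forall fun z y _ => ?_
    have h1 : HasFDerivAt (fun y => k (y - z)) (fderiv ℝ k (y - z)) y := by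
      have := (hk.differentiable one_ne_zero (y - z)).hasFDerivAt.comp y
        ((hasFDerivAt_id y).sub_const z)
      rw [ContinuousLinearMap.comp_id] at this
      exact this
    exact h1.smul_const (f z)

theorem integral_kernel_eq (k : E → ℝ) (f : E → Y) (x : E) :
    ∫ z, k z • f (x - z) = ∫ z, k (x - z) • f z := by
  rw [← integral_sub_left_eq_self _ _ x]
  simp

theorem fderiv_integral_kernel [CompleteSpace Y] {k : E → ℝ} (hk : ContDiff ℝ 1 k) {f : E → Y}
    (hf : Continuous f) (hs : HasCompactSupport f) (x v : E) :
    DifferentiableAt ℝ (fun x => ∫ z, k z • f (x - z)) x ∧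
    fderiv ℝ (fun x => ∫ z, k z • f (x - z)) x v = ∫ z, fderiv ℝ k z v • f (x - z) := by
  have hk' : Continuous (fderiv ℝ k) := hk.continuous_fderiv one_ne_zero
  have h := hasFDerivAt_integral_kernel hk hf hs x
  simp_rw [← integral_kernel_eq] at h
  refine ⟨h.differentiableAt, ?_⟩
  rw [h.fderiv, ContinuousLinearMap.integral_apply]
  · rw [integral_kernel_eq (fun z => fderiv ℝ k z v)]
    rfl
  · refine Continuous.integrable_of_hasCompactSupport (by fun_prop) ?_
    refine hs.mono fun z hz => ?_
    contrapose! hz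
    simp only [Function.mem_support, not_not] at hz ⊢
    ext
    simp [hz]

theorem enorm_taylor_remainder_le [CompleteSpace Y] {G G' G'' : ℝ → Y}
    (h1 : ∀ s, HasDerivAt G (G' s) s) (h2 : ∀ s, HasDerivAt G' (G'' s) s) (hc : Continuous G'') :
    ‖G 1 - G 0 - G' 0‖ₑ ≤ ∫⁻ s in Ioc (0 : ℝ) 1, ‖G'' s‖ₑ := by
  -- This primitive of `(1 - s) G''` encodes the integral form of the remainder; the factor `1 - s`
  -- is later bounded by `1`.
  have h3 : ∀ s, HasDerivAt (fun s => G s + (1 - s) • G' s) ((1 - s) • G'' s) s := by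
    intro s
    have := (h1 s).add (((hasDerivAt_id s).const_sub 1).smul (h2 s))
    refine this.congr_deriv ?_
    simp
  have h4 := intervalIntegral.integral_eq_sub_of_hasDerivAt (a := 0) (b := 1)
    (fun s _ => h3 s) (Continuous.intervalIntegrable (by fun_prop) _ _)
  have h5 : G 1 - G 0 - G' 0 = ∫ s in (0 : ℝ)..1, (1 - s) • G'' s := by
    rw [h4]
    simp
    abel
  rw [h5, intervalIntegral.integral_of_le zero_le_one]
  refine (enorm_integral_le_lintegral_enorm _).trans ?_
  refine setLIntegral_mono' measurableSet_Ioc fun s hs => ?_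
  rw [enorm_smul]
  refine mul_le_of_le_one_left zero_le ?_
  rw [Real.enorm_eq_ofReal (by linarith [hs.2]), ENNReal.ofReal_le_one]
  linarith [hs.1]

theorem contDiff_heatKernel (t : ℝ) {m : WithTop ℕ∞} : ContDiff ℝ m (heatKernel t : E → ℝ) := by
  unfold heatKernel
  exact contDiff_const.mul (Real.contDiff_exp.comp (((contDiff_norm_sq ℝ).neg).div_const _))

theorem fderiv_heatKernel (t : ℝ) (z v : E) :
    fderiv ℝ (heatKernel t) z v = -(inner ℝ z v / (2 * t)) * heatKernel t z := by
  have h : HasFDerivAt (fun z : E => heatKernel t z) _ z :=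
    ((((hasStrictFDerivAt_norm_sq z).hasFDerivAt.neg).mul_const (4 * t)⁻¹).exp).const_mul
      (1 / (4 * Real.pi * t) ^ ((n : ℝ) / 2))
  have h' := h.fderiv
  rw [show (fun z : E => heatKernel t z) = heatKernel t from rfl] at h'
  rw [h', heatKernel]
  simp [div_eq_mul_inv]
  ring

/-- The second derivative of the heat kernel in the direction `v`. -/
noncomputable def heatKernelSecond (t : ℝ) (v z : E) : ℝ :=
  ((inner ℝ z v) ^ 2 / (4 * t ^ 2) - ‖v‖ ^ 2 / (2 * t)) * heatKernel t z

theorem fderiv_inner_mul_heatKernel (t : ℝ) (z v : E) :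
    fderiv ℝ (fun z => -(inner ℝ z v / (2 * t)) * heatKernel t z) z v =
      heatKernelSecond t v z := by
  have h1 : HasFDerivAt (fun z : E => -(inner ℝ z v / (2 * t)))
      (-((2 * t)⁻¹ • innerSL ℝ v)) z := by
    have := (((innerSL ℝ v).hasFDerivAt (x := z)).mul_const (2 * t)⁻¹).neg
    refine this.congr_of_eventuallyEq (.of_forall fun y => ?_)
    simp [div_eq_mul_inv, real_inner_comm]
  have h2 := h1.mul ((contDiff_heatKernel t).differentiable one_ne_zero z).hasFDerivAt
  change fderiv ℝ ((fun z : E => -(inner ℝ z v / (2 * t))) * heatKernel t) z v = _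
  rw [h2.fderiv, heatKernelSecond]
  simp only [add_apply, smul_apply, fderiv_heatKernel,
    neg_apply, innerSL_apply_apply, real_inner_self_eq_norm_sq, smul_eq_mul]
  ring

theorem contDiff_inner_mul_heatKernel (t : ℝ) (v : E) :
    ContDiff ℝ 1 fun z : E => -(inner ℝ z v / (2 * t)) * heatKernel t z := by
  have := contDiff_heatKernel (n := n) t (m := 1)
  have hi : ContDiff ℝ 1 fun z : E => inner ℝ z v := contDiff_id.inner ℝ contDiff_const
  fun_prop

theorem contDiff_heatKernelSecond (t : ℝ) (v : E) : ContDiff ℝ 1 (heatKernelSecond t v) := by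
  have := contDiff_heatKernel (n := n) t (m := 1)
  have hi : ContDiff ℝ 1 fun z : E => inner ℝ z v := contDiff_id.inner ℝ contDiff_const
  unfold heatKernelSecond
  fun_prop

theorem enorm_heat_sub_taylorOne_le [CompleteSpace Y] {f : E → Y} (hf : Continuous f)
    (hs : HasCompactSupport f) (t : ℝ) (x v : E) :
    ‖heat t f (x + v) - taylorOne (heat t f) x (x + v)‖ₑ ≤
      ∫⁻ s in Ioc (0 : ℝ) 1, ‖∫ z, heatKernelSecond t v z • f (x + s • v - z)‖ₑ := by
  have hline : ∀ {k : E → ℝ}, ContDiff ℝ 1 k → ∀ s : ℝ,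
      HasDerivAt (fun s : ℝ => ∫ z, k z • f (x + s • v - z))
        (∫ z, fderiv ℝ k z v • f (x + s • v - z)) s := by
    intro k hk s
    obtain ⟨hd, he⟩ := fderiv_integral_kernel hk hf hs (x + s • v) v
    have hl : HasDerivAt (fun s : ℝ => x + s • v) v s := by
      simpa using ((hasDerivAt_id s).smul_const v).const_add x
    have := hd.hasFDerivAt.comp_hasDerivAt s hl
    rw [he] at this
    exact this
  have h1 := hline (contDiff_heatKernel t)
  have h2 := hline (contDiff_inner_mul_heatKernel t v)
  simp_rw [fderiv_heatKernel] at h1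
  simp_rw [fderiv_inner_mul_heatKernel] at h2
  have h3 := enorm_taylor_remainder_le h1 h2
    (continuous_iff_continuousAt.2 fun s => (hline (contDiff_heatKernelSecond t v) s).continuousAt)
  refine le_trans (le_of_eq ?_) h3
  have h4 := (fderiv_integral_kernel (contDiff_heatKernel t) hf hs x v).2
  simp_rw [fderiv_heatKernel] at h4
  congr 1
  have h5 : (heat t f : E → Y) = fun x => ∫ z, heatKernel t z • f (x - z) := rfl
  rw [taylorOne, add_sub_cancel_left, h5, h4]
  simp only [one_smul, zero_smul, add_zero]
  abel

end kernel

/-! ### Heat flow errors as Gaussian averages of second differences. -/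

section gaussianBounds

open ProbabilityTheory

theorem integrable_sq_sub_one_gaussianReal : Integrable (fun s : ℝ => s ^ 2 - 1) (gaussianReal 0 1) :=
  (IsGaussian.memLp_id (gaussianReal 0 1) 2 (by simp)).integrable_sq.sub (integrable_const _)

theorem integral_sq_sub_one_gaussianReal : ∫ s : ℝ, (s ^ 2 - 1) ∂gaussianReal 0 1 = 0 := by
  have h := variance_id_gaussianReal (μ := 0) (v := 1)
  rw [variance_eq_sub (IsGaussian.memLp_id (gaussianReal 0 1) 2 (by simp))] at h
  have hs : Integrable (fun s : ℝ => s ^ 2) (gaussianReal 0 1) :=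
    (IsGaussian.memLp_id (gaussianReal 0 1) 2 (by simp)).integrable_sq
  rw [integral_sub hs (integrable_const _)]
  simp at h ⊢
  linarith

/-- Here `s ^ 2 + 1` dominates the Hermite weight `s ^ 2 - 1`, and `|s|` is the length of the step.
Finiteness makes the final constant a real number. -/
theorem lintegral_sq_add_one_mul_gaussianReal_lt_top :
    ∫⁻ s : ℝ, ENNReal.ofReal (s ^ 2 + 1) * ‖s‖ₑ ∂gaussianReal 0 1 < ∞ := by
  have h3 : Integrable (fun s : ℝ => ‖s‖ ^ 3) (gaussianReal 0 1) :=
    (IsGaussian.memLp_id (gaussianReal 0 1) 3 (by simp)).integrable_norm_pow (by norm_num)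
  have h1 : Integrable (fun s : ℝ => ‖s‖) (gaussianReal 0 1) :=
    (memLp_one_iff_integrable.1 (IsGaussian.memLp_id (gaussianReal 0 1) 1 (by simp))).norm
  refine lt_of_le_of_lt (lintegral_mono fun s => ?_) (h3.add h1).2
  rw [← ofReal_norm s, ← ENNReal.ofReal_mul (by positivity),
    Real.enorm_of_nonneg (by simp only [Pi.add_apply]; positivity)]
  refine ENNReal.ofReal_le_ofReal (le_of_eq ?_)
  simp only [Pi.add_apply]
  rw [Real.norm_eq_abs, ← sq_abs s]
  ring

variable {n : ℕ} {Y : Type*} [NormedAddCommGroup Y] [NormedSpace ℝ Y]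

/-- The weight `s ^ 2 - 1` is even, so `u` may be symmetrized, and has Gaussian mean zero, so `2 u
0` may be subtracted. -/
theorem enorm_integral_sq_sub_one_smul_le [CompleteSpace Y] {u : ℝ → Y} (hu : Continuous u) {C : ℝ}
    (hC : ∀ s, ‖u s‖ ≤ C) :
    ‖∫ s, (s ^ 2 - 1) • u s ∂gaussianReal 0 1‖ₑ ≤
      ∫⁻ s, ENNReal.ofReal (s ^ 2 + 1) * ‖u s + u (-s) - (2 : ℝ) • u 0‖ₑ ∂gaussianReal 0 1 := by
  have hint : ∀ u : ℝ → Y, Continuous u → (∀ s, ‖u s‖ ≤ C) →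
      Integrable (fun s => (s ^ 2 - 1) • u s) (gaussianReal 0 1) := fun u hu hC =>
    integrable_sq_sub_one_gaussianReal.smul_bdd C hu.aestronglyMeasurable (.of_forall hC)
  have hneg : ∫ s, (s ^ 2 - 1) • u (-s) ∂gaussianReal 0 1
      = ∫ s, (s ^ 2 - 1) • u s ∂gaussianReal 0 1 := by
    have h := integral_map (μ := gaussianReal 0 1) (φ := fun s => -s) (by fun_prop)
      (f := fun s => (s ^ 2 - 1) • u s) (Continuous.aestronglyMeasurable (by fun_prop))
    rw [gaussianReal_map_neg, neg_zero] at h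
    simpa using h.symm
  have hzero : ∫ s, (s ^ 2 - 1) • (2 : ℝ) • u 0 ∂gaussianReal 0 1 = 0 := by
    rw [integral_smul_const, integral_sq_sub_one_gaussianReal, zero_smul]
  have hsum : ∫ s, (s ^ 2 - 1) • (u s + u (-s) - (2 : ℝ) • u 0) ∂gaussianReal 0 1
      = (2 : ℝ) • ∫ s, (s ^ 2 - 1) • u s ∂gaussianReal 0 1 := by
    simp_rw [smul_sub, smul_add]
    rw [integral_sub, integral_add (hint u hu hC) (hint (fun s => u (-s)) (by fun_prop)
      fun s => hC _), hneg, hzero, sub_zero, two_smul]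
    · exact (hint u hu hC).add (hint (fun s => u (-s)) (by fun_prop) fun s => hC _)
    · exact integrable_sq_sub_one_gaussianReal.smul_const _
  have h2 : ‖∫ s, (s ^ 2 - 1) • u s ∂gaussianReal 0 1‖ₑ ≤
      ‖∫ s, (s ^ 2 - 1) • (u s + u (-s) - (2 : ℝ) • u 0) ∂gaussianReal 0 1‖ₑ := by
    rw [hsum, enorm_smul]
    refine le_mul_of_one_le_left zero_le ?_
    rw [Real.enorm_of_nonneg zero_le_two]
    simp
  refine h2.trans ((enorm_integral_le_lintegral_enorm _).trans (lintegral_mono fun s => ?_))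
  rw [enorm_smul]
  gcongr
  rw [← ofReal_norm]
  refine ENNReal.ofReal_le_ofReal ?_
  rw [Real.norm_eq_abs, abs_le]
  constructor <;> nlinarith [sq_nonneg s]

local notation "E" => EuclideanSpace ℝ (Fin n)

/-- The symmetric second difference `f (x + u) + f (x - u) - 2 f x`. -/
def secondDiff (f : E → Y) (u x : E) : Y := f (x + u) + f (x - u) - (2 : ℝ) • f x

theorem heat_eq_integral_stdGaussian {t : ℝ} (ht : 0 < t) (f : E → Y) (x : E) :
    heat t f x = ∫ g, f (x - √(2 * t) • g) ∂stdGaussian E :=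
  integral_heatKernel_smul ht fun z => f (x - z)

/-- Gaussian symmetry makes the mean of the second difference equal to `2 (H f - f)`. -/
theorem enorm_sub_heat_le [CompleteSpace Y] {f : E → Y} (hf : Continuous f)
    (hs : HasCompactSupport f) {t : ℝ} (ht : 0 < t) (x : E) :
    ‖f x - heat t f x‖ₑ ≤ ∫⁻ g, ‖secondDiff f (√(2 * t) • g) x‖ₑ ∂stdGaussian E := by
  obtain ⟨C, hC⟩ := hf.bounded_above_of_compact_support hs
  have h1 := heat_eq_integral_stdGaussian ht f x
  have h2 : heat t f x = ∫ g, f (x + √(2 * t) • g) ∂stdGaussian E := by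
    have h := integral_map (μ := stdGaussian E) (φ := fun g => -g) (by fun_prop)
      (f := fun g => f (x + √(2 * t) • g)) (Continuous.aestronglyMeasurable (by fun_prop))
    rw [map_neg_stdGaussian] at h
    rw [h1, h]
    simp [sub_eq_add_neg]
  have hi : ∀ F : E → E, Continuous F → Integrable (fun g => f (F g)) (stdGaussian E) :=
    fun F hF => .of_bound (Continuous.aestronglyMeasurable (by fun_prop)) C
      (.of_forall fun g => hC _)
  have h3 : ∫ g, secondDiff f (√(2 * t) • g) x ∂stdGaussian E
      = (2 : ℝ) • (heat t f x - f x) := by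
    unfold secondDiff
    have hp := hi (fun g => x + √(2 * t) • g) (by fun_prop)
    have hm := hi (fun g => x - √(2 * t) • g) (by fun_prop)
    rw [integral_sub (by exact hp.add hm) (integrable_const _), integral_add hp hm, ← h1, ← h2]
    simp [two_smul]
    abel
  refine le_trans ?_ (enorm_integral_le_lintegral_enorm _)
  rw [h3, enorm_smul, ← enorm_neg, neg_sub]
  refine le_mul_of_one_le_left zero_le ?_
  rw [Real.enorm_of_nonneg zero_le_two]
  simp

/-- The second derivative of the kernel along `e` is a Gaussian density times `⟨e, g⟩ ^ 2 - 1`.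
Resampling the component along `e` freezes the orthogonal part, and the one-dimensional
symmetrization then acts only in the direction `e`, with no dependence on the dimension. -/
theorem enorm_integral_heatKernelSecond_le [CompleteSpace Y] {f : E → Y} (hf : Continuous f)
    (hs : HasCompactSupport f) {t : ℝ} (ht : 0 < t) {e : E} (he : ‖e‖ = 1) (ρ : ℝ) (x : E) :
    ‖∫ z, heatKernelSecond t (ρ • e) z • f (x - z)‖ₑ ≤ ENNReal.ofReal (ρ ^ 2 / (2 * t)) *
      ∫⁻ w, ∫⁻ s, ENNReal.ofReal (s ^ 2 + 1) *
        ‖secondDiff f ((√(2 * t) * s) • e) (x - √(2 * t) • (w - inner ℝ e w • e))‖ₑ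
          ∂gaussianReal 0 1 ∂stdGaussian E := by
  obtain ⟨C, hC⟩ := hf.bounded_above_of_compact_support hs
  set σ := √(2 * t) with hσ
  have hσ2 : σ ^ 2 = 2 * t := Real.sq_sqrt (by positivity)
  have h1 : ∫ z, heatKernelSecond t (ρ • e) z • f (x - z) =
      (ρ ^ 2 / (2 * t)) • ∫ g, ((inner ℝ e g) ^ 2 - 1) • f (x - σ • g) ∂stdGaussian E := by
    have : ∀ z, heatKernelSecond t (ρ • e) z • f (x - z) = heatKernel t z •
        (((inner ℝ z (ρ • e)) ^ 2 / (4 * t ^ 2) - ‖ρ • e‖ ^ 2 / (2 * t)) • f (x - z)) := by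
      intro z
      rw [heatKernelSecond, mul_comm, mul_smul]
    simp_rw [this]
    rw [integral_heatKernel_smul ht, ← integral_smul]
    refine integral_congr_ae (.of_forall fun g => ?_)
    simp only
    rw [smul_smul]
    congr 1
    rw [inner_smul_left, inner_smul_right, norm_smul, he, real_inner_comm, mul_one,
      Real.norm_eq_abs, sq_abs]
    simp only [conj_trivial]
    rw [mul_pow, ← hσ, hσ2]
    field_simp
    ring
  have h2 : ∫ g, ((inner ℝ e g) ^ 2 - 1) • f (x - σ • g) ∂stdGaussian E =
      ∫ p : E × ℝ, (p.2 ^ 2 - 1) • f (x - σ • (p.1 - inner ℝ e p.1 • e) - (σ * p.2) • e)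
        ∂(stdGaussian E).prod (gaussianReal 0 1) := by
    nth_rewrite 1 [← map_resample_stdGaussian he]
    rw [integral_map (Continuous.aemeasurable (by fun_prop))
      (Continuous.aestronglyMeasurable (by fun_prop))]
    refine integral_congr_ae (.of_forall fun p => ?_)
    have e1 : inner ℝ e (p.1 - inner ℝ e p.1 • e + p.2 • e) = p.2 := by
      simp [inner_add_right, inner_sub_right, inner_smul_right, he]
    simp only [e1]
    congr 2
    module
  have hint : Integrable (fun p : E × ℝ => (p.2 ^ 2 - 1) •
      f (x - σ • (p.1 - inner ℝ e p.1 • e) - (σ * p.2) • e))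
        ((stdGaussian E).prod (gaussianReal 0 1)) := by
    have h := (integrable_const (μ := stdGaussian E) (1 : ℝ)).mul_prod
      integrable_sq_sub_one_gaussianReal
    simp only [one_mul] at h
    exact h.smul_bdd C (Continuous.aestronglyMeasurable (by fun_prop)) (.of_forall fun p => hC _)
  rw [h1, h2, enorm_smul, Real.enorm_of_nonneg (by positivity), integral_prod _ hint]
  gcongr
  refine (enorm_integral_le_lintegral_enorm _).trans (lintegral_mono fun w => ?_)
  refine (enorm_integral_sq_sub_one_smul_le (C := C)
    (u := fun s => f (x - σ • (w - inner ℝ e w • e) - (σ * s) • e)) (by fun_prop)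
    fun s => hC _).trans (lintegral_mono fun s => ?_)
  refine le_of_eq ?_
  congr 2
  simp only [secondDiff, mul_neg, neg_smul, sub_neg_eq_add, mul_zero, zero_smul, sub_zero]
  abel

/-- The averages that control the remainder of the first order Taylor expansion of `heat t f`. -/
noncomputable def taylorMajorant (f : E → Y) (t : ℝ) (x v : E) : ℝ≥0∞ :=
  ENNReal.ofReal (‖v‖ ^ 2 / (2 * t)) *
    ∫⁻ p : ℝ × E × ℝ, ENNReal.ofReal (p.2.2 ^ 2 + 1) *
      ‖secondDiff f ((√(2 * t) * p.2.2) • ‖v‖⁻¹ • v) (x + p.1 • v -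
        √(2 * t) • (p.2.1 - inner ℝ (‖v‖⁻¹ • v) p.2.1 • ‖v‖⁻¹ • v))‖ₑ
      ∂(volume.restrict (Ioc (0 : ℝ) 1)).prod ((stdGaussian E).prod (gaussianReal 0 1))

theorem enorm_heat_sub_taylorOne_le_majorant [CompleteSpace Y] {f : E → Y} (hf : Continuous f)
    (hs : HasCompactSupport f) {t : ℝ} (ht : 0 < t) (x v : E) :
    ‖heat t f (x + v) - taylorOne (heat t f) x (x + v)‖ₑ ≤ taylorMajorant f t x v := by
  rcases eq_or_ne v 0 with rfl | hv
  · simp [taylorOne]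
  have hv' : ‖v‖ ≠ 0 := norm_ne_zero_iff.2 hv
  set e := ‖v‖⁻¹ • v with he
  have he1 : ‖e‖ = 1 := by rw [he, norm_smul, norm_inv, norm_norm, inv_mul_cancel₀ hv']
  have hve : v = ‖v‖ • e := by rw [he, smul_smul, mul_inv_cancel₀ hv', one_smul]
  have hm : ∀ {p : ℝ × E × ℝ → E} {r : ℝ × E × ℝ → E}, Continuous p → Continuous r →
      Measurable fun z : ℝ × E × ℝ => ENNReal.ofReal (z.2.2 ^ 2 + 1) *
      ‖secondDiff f (p z) (r z)‖ₑ := by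
    intro p r hp hr
    unfold secondDiff
    have m1 : Measurable fun z : ℝ × E × ℝ => ENNReal.ofReal (z.2.2 ^ 2 + 1) := by fun_prop
    have m2 : Continuous fun z : ℝ × E × ℝ =>
        ‖f (r z + p z) + f (r z - p z) - (2 : ℝ) • f (r z)‖ₑ := by fun_prop
    exact m1.mul m2.measurable
  have hmeas := hm (p := fun p => (√(2 * t) * p.2.2) • e) (r := fun p => x + p.1 • v -
        √(2 * t) • (p.2.1 - inner ℝ e p.2.1 • e)) (by fun_prop) (by fun_prop)
  refine (enorm_heat_sub_taylorOne_le hf hs t x v).trans ?_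
  rw [taylorMajorant, ← he, lintegral_prod _ hmeas.aemeasurable,
    ← lintegral_const_mul _ hmeas.lintegral_prod_right']
  refine lintegral_mono fun θ => ?_
  have h := enorm_integral_heatKernelSecond_le hf hs ht he1 ‖v‖ (x + θ • v)
  rw [← hve] at h
  refine h.trans (le_of_eq ?_)
  congr 1
  rw [lintegral_prod]
  exact (hmeas.comp (measurable_prodMk_left (x := θ))).aemeasurable

end gaussianBounds

/-! ### Balls of `X`, their averages, and Lipschitz functions. -/

section ball

variable {n : ℕ} {X : Type*} [NormedAddCommGroup X] [NormedSpace ℝ X]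

local notation "E" => EuclideanSpace ℝ (Fin n)

theorem isClosed_ballX (T : E ≃ₗ[ℝ] X) (x : E) (t : ℝ) : IsClosed (ballX T x t) := by
  have hT : Continuous T := T.toLinearMap.continuous_of_finiteDimensional
  exact isClosed_le (by fun_prop) continuous_const

theorem isCompact_ballX_unit (T : E ≃ₗ[ℝ] X) : IsCompact (ballX T 0 1) := by
  have : FiniteDimensional ℝ X := T.finiteDimensional
  have hT' : Continuous T.symm := T.symm.toLinearMap.continuous_of_finiteDimensional
  have : ProperSpace X := FiniteDimensional.proper ℝ X
  refine ((isCompact_closedBall (0 : X) 1).image hT').of_isClosed_subset (isClosed_ballX T 0 1) ?_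
  intro b hb
  refine ⟨T b, ?_, by simp⟩
  simpa [ballX] using hb

theorem volume_ballX_unit_ne_zero (T : E ≃ₗ[ℝ] X) : volume (ballX T 0 1) ≠ 0 := by
  have hT : Continuous T := T.toLinearMap.continuous_of_finiteDimensional
  have hopen : IsOpen {b : E | ‖T b‖ < 1} := isOpen_lt (by fun_prop) continuous_const
  have hpos := hopen.measure_pos volume ⟨0, by simp⟩
  refine (hpos.trans_le (measure_mono fun b hb => ?_)).ne'
  simpa [ballX] using (le_of_lt hb : ‖T b‖ ≤ 1)

theorem volume_ballX_unit_ne_top (T : E ≃ₗ[ℝ] X) : volume (ballX T 0 1) ≠ ∞ :=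
  (isCompact_ballX_unit T).measure_lt_top.ne

theorem setLIntegral_ballX (T : E ≃ₗ[ℝ] X) (x : E) {t : ℝ} (ht : 0 < t) (F : E → ℝ≥0∞) :
    ∫⁻ y in ballX T x t, F y = ENNReal.ofReal (t ^ n) * ∫⁻ b in ballX T 0 1, F (x + t • b) := by
  rw [← lintegral_indicator (isClosed_ballX T x t).measurableSet,
    ← lintegral_indicator (isClosed_ballX T 0 1).measurableSet, ← lintegral_add_left_eq_self _ x,
    lintegral_comp_smul volume _ ht, finrank_euclideanSpace_fin]
  congr 1
  refine lintegral_congr fun b => ?_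
  have : x + t • b ∈ ballX T x t ↔ b ∈ ballX T 0 1 := by
    simp [ballX, norm_smul, abs_of_pos ht, ht]
  by_cases hb : b ∈ ballX T 0 1
  · rw [indicator_of_mem hb, indicator_of_mem (this.2 hb)]
  · rw [indicator_of_notMem hb, indicator_of_notMem fun h => hb (this.1 h)]

theorem laverage_ballX (T : E ≃ₗ[ℝ] X) (x : E) {t : ℝ} (ht : 0 < t) (F : E → ℝ≥0∞) :
    ⨍⁻ y, F y ∂(volume.restrict (ballX T x t)) =
      ⨍⁻ b, F (x + t • b) ∂(volume.restrict (ballX T 0 1)) := by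
  have h1 := setLIntegral_ballX T x ht (fun _ => 1)
  simp only [setLIntegral_one] at h1
  rw [setLAverage_eq, setLAverage_eq, setLIntegral_ballX T x ht, h1]
  exact ENNReal.mul_div_mul_left _ _ (by simpa using by positivity) (by simp)

theorem laverage_enorm_rpow_ballX (T : E ≃ₗ[ℝ] X) {q : ℝ} (hq : 0 < q) :
    ⨍⁻ b, ‖b‖ₑ ^ q ∂(volume.restrict (ballX T 0 1)) = ENNReal.ofReal (meanRadius q T) ^ q := by
  have hint : IntegrableOn (fun b : E => ‖b‖ ^ q) (ballX T 0 1) :=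
    (continuous_norm.rpow_const fun _ => Or.inr hq.le).continuousOn.integrableOn_compact
      (isCompact_ballX_unit T)
  have h1 : ∫⁻ b in ballX T 0 1, ‖b‖ₑ ^ q = ENNReal.ofReal (∫ b in ballX T 0 1, ‖b‖ ^ q) := by
    rw [ofReal_integral_eq_lintegral_ofReal hint
      (by filter_upwards with x using Real.rpow_nonneg (norm_nonneg _) _)]
    refine lintegral_congr fun b => ?_
    rw [← ofReal_norm, ENNReal.ofReal_rpow_of_nonneg (norm_nonneg _) hq.le]
  have h0 : 0 ≤ ⨍ x in ballX T 0 1, ‖x‖ ^ q := by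
    rw [setAverage_eq]
    exact smul_nonneg (by positivity) (integral_nonneg fun x => by positivity)
  rw [meanRadius, ENNReal.ofReal_rpow_of_nonneg (by positivity) hq.le, ← Real.rpow_mul h0,
    one_div_mul_cancel hq.ne', Real.rpow_one, setLAverage_eq, setAverage_eq, h1, smul_eq_mul,
    ENNReal.ofReal_mul (by positivity), Measure.real, ENNReal.ofReal_inv_of_pos
      (ENNReal.toReal_pos (volume_ballX_unit_ne_zero T) (volume_ballX_unit_ne_top T)),
    ENNReal.ofReal_toReal (volume_ballX_unit_ne_top T), mul_comm, div_eq_mul_inv]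

theorem meanRadius_pos (T : E ≃ₗ[ℝ] X) (hn : 1 ≤ n) {q : ℝ} (hq : 0 < q) : 0 < meanRadius q T := by
  have : Nonempty (Fin n) := ⟨⟨0, hn⟩⟩
  by_contra hcon
  have h := laverage_enorm_rpow_ballX T hq
  rw [ENNReal.ofReal_of_nonpos (not_lt.1 hcon), ENNReal.zero_rpow_of_pos hq, setLAverage_eq,
    ENNReal.div_eq_zero_iff, or_iff_left (volume_ballX_unit_ne_top T),
    lintegral_eq_zero_iff (by fun_prop)] at h
  have h2 : ∀ᵐ b : E ∂volume.restrict (ballX T 0 1), b ≠ 0 :=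
    ae_restrict_of_ae (Measure.ae_ne volume 0)
  have h3 : ∀ᵐ b : E ∂volume.restrict (ballX T 0 1), False := by
    filter_upwards [h, h2] with b hb hb2
    simp [ENNReal.rpow_eq_zero_iff, hq, hb2, not_lt.2 hq.le] at hb
  rw [Filter.eventually_false_iff_eq_bot, ae_eq_bot, Measure.restrict_eq_zero] at h3
  exact volume_ballX_unit_ne_zero T h3

variable {Y : Type*} [NormedAddCommGroup Y]

theorem enorm_sub_le_lipNorm_mul (T : E ≃ₗ[ℝ] X) (f : E → Y) (x y : E) :
    ‖f x - f y‖ₑ ≤ lipNorm T f * ‖T (x - y)‖ₑ := by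
  rcases eq_or_ne x y with rfl | hxy
  · simp
  have h : ‖f x - f y‖ₑ / ‖T (x - y)‖ₑ ≤ lipNorm T f :=
    le_iSup_of_le x <| le_iSup_of_le y <| le_iSup_of_le hxy le_rfl
  refine (ENNReal.div_le_iff ?_ enorm_ne_top).1 h
  rw [enorm_ne_zero, T.map_ne_zero_iff]
  exact sub_ne_zero.2 hxy

theorem continuous_of_lipNorm_lt_top (T : E ≃ₗ[ℝ] X) {f : E → Y} (hL : lipNorm T f < ∞) : Continuous f := by
  let T' : E →L[ℝ] X := LinearMap.toContinuousLinearMap T.toLinearMap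
  have h : LipschitzWith ((lipNorm T f).toNNReal * ‖T'‖₊) f := by
    intro x y
    rw [edist_eq_enorm_sub, edist_eq_enorm_sub, ENNReal.coe_mul, ENNReal.coe_toNNReal hL.ne,
      mul_assoc]
    refine (enorm_sub_le_lipNorm_mul T f x y).trans ?_
    gcongr
    exact T'.le_opENorm (x - y)
  exact h.continuous

end ball

/-! ### Bounds in `L_q` for the two majorants. -/

section assembly

open ProbabilityTheory

variable {n : ℕ} {q : ℝ} {X : Type*} [NormedAddCommGroup X] [NormedSpace ℝ X]
  {Y : Type*} [NormedAddCommGroup Y] [NormedSpace ℝ Y]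

local notation "E" => EuclideanSpace ℝ (Fin n)

/-- The measure `t ^ (-(q + 1)) dt` on the positive half-line. -/
noncomputable def scaleMeasure (q : ℝ) : Measure ℝ :=
  (volume.restrict (Ioi (0 : ℝ))).withDensity fun t => (ENNReal.ofReal (t ^ (q + 1)))⁻¹

instance : SFinite (scaleMeasure q) := by
  unfold scaleMeasure
  infer_instance

theorem lintegral_scaleMeasure {F : ℝ → ℝ≥0∞} (hF : Measurable F) :
    ∫⁻ t, F t ∂scaleMeasure q = ∫⁻ t in Ioi (0 : ℝ), F t / ENNReal.ofReal (t ^ (q + 1)) := by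
  rw [scaleMeasure, lintegral_withDensity_eq_lintegral_mul _ (by fun_prop) hF]
  refine lintegral_congr fun t => ?_
  rw [Pi.mul_apply, mul_comm, div_eq_mul_inv]

/-- The shift `S t` of the base point is harmless: for each fixed `t` the integral in `x` is
translation invariant. -/
theorem lintegral_secondDiff_shift_le [CompleteSpace Y] (hq : 1 ≤ q) (T : E ≃ₗ[ℝ] X) {f : E → Y}
    (hf : Continuous f) (v : E) {S : ℝ → E} (hS : Continuous S) :
    ∫⁻ p : ℝ × E, ‖secondDiff f (p.1 • v) (p.2 + S p.1)‖ₑ ^ q ∂(scaleMeasure q).prod volume ≤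
      4 ^ q * martingaleCotype q Y ^ q * volume (tsupport f) * (lipNorm T f * ‖T v‖ₑ) ^ q := by
  have hc : Continuous fun p : ℝ × E => ‖secondDiff f (p.1 • v) (p.2 + S p.1)‖ₑ := by
    unfold secondDiff
    fun_prop
  rw [lintegral_prod _ (hc.measurable.pow_const q).aemeasurable]
  have h1 : ∀ t, ∫⁻ x, ‖secondDiff f (t • v) (x + S t)‖ₑ ^ q =
      ∫⁻ x, ‖secondDiff f (t • v) x‖ₑ ^ q := fun t =>
    lintegral_add_right_eq_self (fun x => ‖secondDiff f (t • v) x‖ₑ ^ q) (S t)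
  simp_rw [h1]
  unfold secondDiff
  rw [lintegral_scaleMeasure (measurable_lintegral_second_difference hf v)]
  refine (lintegral_second_difference_le hq hf v (lipNorm T f * ‖T v‖ₑ) ?_).trans
    (le_of_eq (by ring))
  intro x r
  refine (enorm_sub_le_lipNorm_mul T f _ _).trans (le_of_eq ?_)
  rw [add_sub_cancel_left, map_smul, enorm_smul]
  ring

/-- The Gaussian average of second differences that controls `f - heat t f`. -/
noncomputable def heatMajorant (f : E → Y) (c t : ℝ) (x : E) : ℝ≥0∞ :=
  ∫⁻ g, ‖secondDiff f (t • c • g) x‖ₑ ∂stdGaussian E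

/-- `taylorMajorant` in rescaled variables. -/
noncomputable def scaledTaylorMajorant (f : E → Y) (c t : ℝ) (x b : E) : ℝ≥0∞ :=
  ENNReal.ofReal (‖b‖ ^ 2 / c ^ 2) *
    ∫⁻ p : ℝ × E × ℝ, ENNReal.ofReal (p.2.2 ^ 2 + 1) *
      ‖secondDiff f (t • (c * p.2.2) • ‖b‖⁻¹ • b) (x + ((p.1 * t) • b -
        (c * t) • (p.2.1 - inner ℝ (‖b‖⁻¹ • b) p.2.1 • ‖b‖⁻¹ • b)))‖ₑ
      ∂(volume.restrict (Ioc (0 : ℝ) 1)).prod ((stdGaussian E).prod (gaussianReal 0 1))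

theorem measurable_heatMajorant {f : E → Y} (hf : Continuous f) (c : ℝ) :
    Measurable fun p : ℝ × E => heatMajorant f c p.1 p.2 := by
  have hc : Continuous fun p : (ℝ × E) × E => ‖secondDiff f (p.1.1 • c • p.2) p.1.2‖ₑ := by
    unfold secondDiff
    fun_prop
  exact hc.measurable.lintegral_prod_right'

theorem measurable_scaledTaylorMajorant {f : E → Y} (hf : Continuous f) (c : ℝ) :
    Measurable fun p : ℝ × E × E => scaledTaylorMajorant f c p.1 p.2.1 p.2.2 := by
  have h1 : Measurable fun p : ℝ × E × E => ENNReal.ofReal (‖p.2.2‖ ^ 2 / c ^ 2) := by fun_prop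
  -- The direction is first an independent variable, in which the integrand is continuous; the
  -- measurable map `b ↦ b / |b|`, discontinuous at the origin, is substituted afterwards.
  have h2 : Measurable fun z : (E × ℝ × E × E) × ℝ × E × ℝ =>
    ENNReal.ofReal (z.2.2.2 ^ 2 + 1) := by fun_prop
  have h3 : Continuous fun z : (E × ℝ × E × E) × ℝ × E × ℝ =>
      ‖secondDiff f (z.1.2.1 • (c * z.2.2.2) • z.1.1) (z.1.2.2.1 + ((z.2.1 * z.1.2.1) • z.1.2.2.2 -
        (c * z.1.2.1) • (z.2.2.1 - inner ℝ z.1.1 z.2.2.1 • z.1.1)))‖ₑ := by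
    unfold secondDiff
    fun_prop
  have h4 := (h2.mul h3.measurable).lintegral_prod_right'
    (ν := (volume.restrict (Ioc (0 : ℝ) 1)).prod ((stdGaussian E).prod (gaussianReal 0 1)))
  have h5 : Measurable fun p : ℝ × E × E => (‖p.2.2‖⁻¹ • p.2.2, p) := by fun_prop
  have h6 := h1.mul (h4.comp h5)
  simp only [Function.comp_def, Pi.mul_def] at h6
  exact h6

theorem lintegral_heatMajorant_le [CompleteSpace Y] (hq : 1 < q) (hn : 1 ≤ n) (T : E ≃ₗ[ℝ] X)
    {f : E → Y} (hf : Continuous f) (hL : lipNorm T f < ∞) {c : ℝ} (hc : 0 ≤ c) :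
    ∫⁻ p : ℝ × E, heatMajorant f c p.1 p.2 ^ q ∂(scaleMeasure q).prod volume ≤
      4 ^ q * martingaleCotype q Y ^ q * volume (tsupport f) *
        (lipNorm T f * ENNReal.ofReal (c * (meanNorm T * √n))) ^ q := by
  have hT : Continuous T := T.toLinearMap.continuous_of_finiteDimensional
  have hcont : Continuous fun p : (ℝ × E) × E => ‖secondDiff f (p.1.1 • c • p.2) p.1.2‖ₑ := by
    unfold secondDiff
    fun_prop
  refine (lintegral_rpow_lintegral_le hq (φ := fun (p : ℝ × E) g => ‖secondDiff f (p.1 • c • g) p.2‖ₑ)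
    hcont.measurable (a := fun g => lipNorm T f * ‖T (c • g)‖ₑ)
    (Measurable.const_mul (Continuous.measurable (by fun_prop)) _)
    (fun g => ENNReal.mul_ne_top hL.ne enorm_ne_top) _ (fun g => by
      simpa using lintegral_secondDiff_shift_le hq.le T hf (c • g) (continuous_const (y := 0)))).trans ?_
  gcongr
  rw [lintegral_const_mul _ (Continuous.measurable (by fun_prop))]
  gcongr
  simp_rw [map_smul, enorm_smul]
  rw [lintegral_const_mul _ (Continuous.measurable (by fun_prop)), ENNReal.ofReal_mul hc,
    Real.enorm_of_nonneg hc]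
  gcongr
  exact lintegral_enorm_map_stdGaussian_le hn T

/-- A third absolute moment of the standard Gaussian. -/
noncomputable def gaussianMoment : ℝ≥0∞ :=
  ∫⁻ s : ℝ, ENNReal.ofReal (s ^ 2 + 1) * ‖s‖ₑ ∂gaussianReal 0 1

theorem lintegral_scaledTaylorMajorant_le [CompleteSpace Y] (hq : 1 < q) (T : E ≃ₗ[ℝ] X)
    {f : E → Y} (hf : Continuous f) (hL : lipNorm T f < ∞) {c : ℝ} (hc : 0 < c) {b : E}
    (hb : ‖T b‖ ≤ 1) :
    ∫⁻ p : ℝ × E, scaledTaylorMajorant f c p.1 p.2 b ^ q ∂(scaleMeasure q).prod volume ≤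
      4 ^ q * martingaleCotype q Y ^ q * volume (tsupport f) *
        (lipNorm T f * gaussianMoment * ENNReal.ofReal c⁻¹) ^ q * ‖b‖ₑ ^ q := by
  have hq0 : 0 < q := by linarith
  set e := ‖b‖⁻¹ • b with he
  set A := 4 ^ q * martingaleCotype q Y ^ q * volume (tsupport f) with hA
  have h1 : Measurable fun p : (ℝ × E) × ℝ × E × ℝ => ENNReal.ofReal (p.2.2.2 ^ 2 + 1) := by
    fun_prop
  have h2 : Continuous fun p : (ℝ × E) × ℝ × E × ℝ =>
      ‖secondDiff f (p.1.1 • (c * p.2.2.2) • e) (p.1.2 + ((p.2.1 * p.1.1) • b -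
        (c * p.1.1) • (p.2.2.1 - inner ℝ e p.2.2.1 • e)))‖ₑ := by
    unfold secondDiff
    fun_prop
  have h3 : Measurable fun s : ℝ => ENNReal.ofReal (s ^ 2 + 1) * ‖s‖ₑ := by fun_prop
  have key := lintegral_rpow_lintegral_le (μ := (scaleMeasure q).prod (volume : Measure E))
    (ν := (volume.restrict (Ioc (0 : ℝ) 1)).prod ((stdGaussian E).prod (gaussianReal 0 1))) hq
    (φ := fun (p : ℝ × E) (w : ℝ × E × ℝ) => ENNReal.ofReal (w.2.2 ^ 2 + 1) *
      ‖secondDiff f (p.1 • (c * w.2.2) • e) (p.2 + ((w.1 * p.1) • b -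
        (c * p.1) • (w.2.1 - inner ℝ e w.2.1 • e)))‖ₑ)
    (h1.mul h2.measurable)
    (a := fun w => (lipNorm T f * ENNReal.ofReal c * ‖T e‖ₑ) *
      (ENNReal.ofReal (w.2.2 ^ 2 + 1) * ‖w.2.2‖ₑ)) (by fun_prop)
    (fun w => by finiteness) A (by
      intro w
      have h := lintegral_secondDiff_shift_le hq.le T hf ((c * w.2.2) • e)
        (S := fun t => (w.1 * t) • b - (c * t) • (w.2.1 - inner ℝ e w.2.1 • e)) (by fun_prop)
      simp_rw [ENNReal.mul_rpow_of_nonneg _ _ hq0.le]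
      rw [lintegral_const_mul' _ _ (by finiteness)]
      refine (mul_le_mul_right h _).trans (le_of_eq ?_)
      rw [map_smul, enorm_smul, enorm_mul, Real.enorm_of_nonneg hc.le, ← hA]
      simp_rw [ENNReal.mul_rpow_of_nonneg _ _ hq0.le]
      ring)
  have h4 : ∫⁻ w : ℝ × E × ℝ, (lipNorm T f * ENNReal.ofReal c * ‖T e‖ₑ) *
      (ENNReal.ofReal (w.2.2 ^ 2 + 1) * ‖w.2.2‖ₑ)
      ∂(volume.restrict (Ioc (0 : ℝ) 1)).prod ((stdGaussian E).prod (gaussianReal 0 1))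
      = lipNorm T f * ENNReal.ofReal c * ‖T e‖ₑ * gaussianMoment := by
    rw [lintegral_const_mul _ (by fun_prop), lintegral_prod _ (by fun_prop)]
    simp only
    rw [lintegral_const, lintegral_prod _ (by fun_prop)]
    simp [gaussianMoment]
  rw [h4] at key
  simp only [scaledTaylorMajorant, ← he]
  simp_rw [ENNReal.mul_rpow_of_nonneg _ _ hq0.le]
  simp_rw [ENNReal.mul_rpow_of_nonneg _ _ hq0.le] at key
  rw [lintegral_const_mul' _ _ (by finiteness)]
  refine (mul_le_mul_right key _).trans ?_
  -- The hypothesis `‖T b‖ ≤ 1` gives `‖T e‖ ≤ 1 / |b|` for `b ≠ 0`, which turns the quadratic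
  -- prefactor into the linear weight `|b| / c`.
  have h5 : ENNReal.ofReal (‖b‖ ^ 2 / c ^ 2) * (ENNReal.ofReal c * ‖T e‖ₑ) ≤
      ENNReal.ofReal c⁻¹ * ‖b‖ₑ := by
    rw [← ofReal_norm (T e), ← ofReal_norm b, ← ENNReal.ofReal_mul hc.le,
      ← ENNReal.ofReal_mul (by positivity), ← ENNReal.ofReal_mul (by positivity)]
    refine ENNReal.ofReal_le_ofReal ?_
    have h6 : ‖b‖ ^ 2 * ‖T e‖ ≤ ‖b‖ := by
      rcases eq_or_ne b 0 with rfl | hb0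
      · simp
      have : ‖b‖ ≠ 0 := norm_ne_zero_iff.2 hb0
      rw [he, map_smul, norm_smul, norm_inv, norm_norm]
      calc ‖b‖ ^ 2 * (‖b‖⁻¹ * ‖T b‖) = ‖b‖ * ‖T b‖ := by field_simp
        _ ≤ ‖b‖ := mul_le_of_le_one_right (norm_nonneg _) hb
    calc ‖b‖ ^ 2 / c ^ 2 * (c * ‖T e‖) = c⁻¹ * (‖b‖ ^ 2 * ‖T e‖) := by field_simp
      _ ≤ c⁻¹ * ‖b‖ := by gcongr
  have h7 := ENNReal.rpow_le_rpow h5 hq0.le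
  simp_rw [ENNReal.mul_rpow_of_nonneg _ _ hq0.le] at h7
  calc _ = A * (lipNorm T f ^ q * gaussianMoment ^ q) * (ENNReal.ofReal (‖b‖ ^ 2 / c ^ 2) ^ q *
        (ENNReal.ofReal c ^ q * ‖T e‖ₑ ^ q)) := by ring
    _ ≤ A * (lipNorm T f ^ q * gaussianMoment ^ q) * (ENNReal.ofReal c⁻¹ ^ q * ‖b‖ₑ ^ q) := by
        gcongr
    _ = _ := by ring

theorem enorm_sub_taylorOne_heat_le [CompleteSpace Y] {f : E → Y} (hf : Continuous f)
    (hs : HasCompactSupport f) {γ : ℝ} (hγ : 0 < γ) {t : ℝ} (ht : 0 < t) (x b : E) :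
    ‖f (x + t • b) - taylorOne (heat (γ * t ^ 2) f) x (x + t • b)‖ₑ ≤
      heatMajorant f (√(2 * γ)) t (x + t • b) + scaledTaylorMajorant f (√(2 * γ)) t x b := by
  have hτ : 0 < γ * t ^ 2 := by positivity
  have hσ : √(2 * (γ * t ^ 2)) = √(2 * γ) * t := by
    rw [← mul_assoc, Real.sqrt_mul (by positivity), Real.sqrt_sq ht.le]
  have hc2 : √(2 * γ) ^ 2 = 2 * γ := Real.sq_sqrt (by positivity)
  have h1 := enorm_sub_heat_le hf hs hτ (x + t • b)
  have h2 := enorm_heat_sub_taylorOne_le_majorant hf hs hτ x (t • b)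
  have e1 : ∫⁻ g, ‖secondDiff f (√(2 * (γ * t ^ 2)) • g) (x + t • b)‖ₑ ∂stdGaussian E =
      heatMajorant f (√(2 * γ)) t (x + t • b) := by
    rw [heatMajorant]
    simp_rw [hσ, smul_smul, mul_comm t]
  have hu : ‖t • b‖⁻¹ • t • b = ‖b‖⁻¹ • b := by
    rw [norm_smul, Real.norm_of_nonneg ht.le, smul_smul]
    congr 1
    field_simp
  have e2 : taylorMajorant f (γ * t ^ 2) x (t • b) = scaledTaylorMajorant f (√(2 * γ)) t x b := by
    rw [taylorMajorant, scaledTaylorMajorant, hu, hσ, hc2]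
    congr 1
    · congr 1
      rw [norm_smul, Real.norm_of_nonneg ht.le]
      field_simp
    · refine lintegral_congr fun p => ?_
      congr 3
      · rw [smul_smul t]
        congr 1
        ring
      · rw [smul_smul p.1, add_sub_assoc]
  rw [e1] at h1
  rw [e2] at h2
  calc _ = ‖(f (x + t • b) - heat (γ * t ^ 2) f (x + t • b)) +
        (heat (γ * t ^ 2) f (x + t • b) - taylorOne (heat (γ * t ^ 2) f) x (x + t • b))‖ₑ := by
        rw [sub_add_sub_cancel]
    _ ≤ _ := (enorm_add_le _ _).trans (add_le_add h1 h2)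

end assembly

/-! ### Averaging over the ball and choosing the time scale. -/

section final

open ProbabilityTheory

variable {n : ℕ} {q : ℝ} {X : Type*} [NormedAddCommGroup X] [NormedSpace ℝ X]
  {Y : Type*} [NormedAddCommGroup Y] [NormedSpace ℝ Y]

local notation "E" => EuclideanSpace ℝ (Fin n)

/-- Putting the average over `b` outermost lets the `L_q` estimates be used for one direction `b` at
a time. -/
theorem lintegral_scale_swap {G : ℝ → E → E → ℝ≥0∞}
    (hG : Measurable fun p : ℝ × E × E => G p.1 p.2.1 p.2.2) (ν : Measure E) [SFinite ν] :
    ∫⁻ x, ∫⁻ t in Ioi (0 : ℝ), (∫⁻ b, G t x b ∂ν) / ENNReal.ofReal (t ^ (q + 1)) =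
      ∫⁻ b, ∫⁻ p : ℝ × E, G p.1 p.2 b ∂(scaleMeasure q).prod volume ∂ν := by
  have hG' : Measurable fun p : (ℝ × E) × E => G p.1.1 p.1.2 p.2 :=
    hG.comp (by fun_prop : Measurable fun p : (ℝ × E) × E => (p.1.1, p.1.2, p.2))
  have hI : Measurable fun p : ℝ × E => ∫⁻ b, G p.1 p.2 b ∂ν := hG'.lintegral_prod_right'
  calc _ = ∫⁻ x : E, ∫⁻ t, ∫⁻ b, G t x b ∂ν ∂scaleMeasure q := by
        refine lintegral_congr fun x => ?_
        rw [lintegral_scaleMeasure]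
        exact hI.comp (by fun_prop : Measurable fun t : ℝ => (t, x))
    _ = ∫⁻ t, ∫⁻ x : E, ∫⁻ b, G t x b ∂ν ∂volume ∂scaleMeasure q := by
        refine lintegral_lintegral_swap (f := fun (x : E) t => ∫⁻ b, G t x b ∂ν) ?_
        exact (hI.comp measurable_swap).aemeasurable
    _ = ∫⁻ p : ℝ × E, ∫⁻ b, G p.1 p.2 b ∂ν ∂(scaleMeasure q).prod volume := by
        rw [lintegral_prod _ hI.aemeasurable]
    _ = _ := lintegral_lintegral_swap hG'.aemeasurable

theorem lintegral_taylor_error_le_majorants [CompleteSpace Y] (hq : 1 ≤ q) (T : E ≃ₗ[ℝ] X)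
    {f : E → Y} (hf : Continuous f) (hs : HasCompactSupport f) {γ : ℝ} (hγ : 0 < γ) :
    ∫⁻ x, ∫⁻ t in Ioi (0 : ℝ), ⨍⁻ y,
        ‖f y - taylorOne (heat (γ * t ^ 2) f) x y‖ₑ ^ q / ENNReal.ofReal (t ^ (q + 1))
          ∂(volume.restrict (ballX T x t)) ≤
      ⨍⁻ b, ∫⁻ p : ℝ × E, 2 ^ q * (heatMajorant f (√(2 * γ)) p.1 (p.2 + p.1 • b) ^ q +
        scaledTaylorMajorant f (√(2 * γ)) p.1 p.2 b ^ q) ∂(scaleMeasure q).prod volume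
          ∂(volume.restrict (ballX T 0 1)) := by
  obtain ⟨G, hGdef⟩ : ∃ G : ℝ → E → E → ℝ≥0∞, ∀ t x b, G t x b = 2 ^ q *
      (heatMajorant f (√(2 * γ)) t (x + t • b) ^ q +
        scaledTaylorMajorant f (√(2 * γ)) t x b ^ q) := ⟨_, fun _ _ _ => rfl⟩
  have hG : Measurable fun p : ℝ × E × E => G p.1 p.2.1 p.2.2 := by
    have h1 := (measurable_heatMajorant hf (√(2 * γ))).comp
      (by fun_prop : Measurable fun p : ℝ × E × E => (p.1, p.2.1 + p.1 • p.2.2))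
    have h2 := measurable_scaledTaylorMajorant hf (√(2 * γ))
    simp_rw [hGdef]
    exact ((h1.pow_const q).add (h2.pow_const q)).const_mul _
  simp_rw [← hGdef]
  rw [laverage_eq', ← lintegral_scale_swap hG]
  refine lintegral_mono fun x => setLIntegral_mono' measurableSet_Ioi fun t ht => ?_
  have hGm : Measurable fun b => G t x b := hG.comp (by fun_prop : Measurable fun b => (t, x, b))
  rw [laverage_ballX T x ht, laverage_eq', div_eq_mul_inv, ← lintegral_mul_const _ hGm]
  refine lintegral_mono fun b => ?_
  simp only [div_eq_mul_inv]
  gcongr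
  refine (ENNReal.rpow_le_rpow (enorm_sub_taylorOne_heat_le hf hs hγ ht x b)
    (by linarith)).trans ?_
  refine (ENNReal.rpow_add_le_mul_rpow_add_rpow _ _ hq).trans ?_
  rw [hGdef]
  gcongr
  · norm_num
  · linarith

theorem lintegral_taylor_error_le [CompleteSpace Y] (hq : 1 < q) (hn : 1 ≤ n) (T : E ≃ₗ[ℝ] X)
    {f : E → Y} (hL : lipNorm T f < ∞) (hs : HasCompactSupport f) {γ : ℝ} (hγ : 0 < γ) :
    ∫⁻ x, ∫⁻ t in Ioi (0 : ℝ), ⨍⁻ y,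
        ‖f y - taylorOne (heat (γ * t ^ 2) f) x y‖ₑ ^ q / ENNReal.ofReal (t ^ (q + 1))
          ∂(volume.restrict (ballX T x t)) ≤
      2 ^ q * (4 ^ q * martingaleCotype q Y ^ q * volume (tsupport f)) * lipNorm T f ^ q *
        (ENNReal.ofReal (√(2 * γ) * (meanNorm T * √n)) ^ q +
          (gaussianMoment * ENNReal.ofReal ((√(2 * γ))⁻¹ * meanRadius q T)) ^ q) := by
  have hf := continuous_of_lipNorm_lt_top T hL
  have hq0 : 0 < q := by linarith
  refine (lintegral_taylor_error_le_majorants hq.le T hf hs hγ).trans ?_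
  set c := √(2 * γ)
  have hc : 0 < c := Real.sqrt_pos.2 (by positivity)
  set A := 4 ^ q * martingaleCotype q Y ^ q * volume (tsupport f) with hA
  set P := A * (lipNorm T f * ENNReal.ofReal (c * (meanNorm T * √n))) ^ q with hP
  set Q := A * (lipNorm T f * gaussianMoment * ENNReal.ofReal c⁻¹) ^ q with hQ
  have hm1 : ∀ b : E, Measurable fun p : ℝ × E => heatMajorant f c p.1 (p.2 + p.1 • b) ^ q :=
    fun b => ((measurable_heatMajorant hf c).comp
      (by fun_prop : Measurable fun p : ℝ × E => (p.1, p.2 + p.1 • b))).pow_const q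
  have h1 : ∀ b : E, ∫⁻ p : ℝ × E, heatMajorant f c p.1 (p.2 + p.1 • b) ^ q
      ∂(scaleMeasure q).prod volume ≤ P := by
    intro b
    refine le_trans (le_of_eq ?_) (lintegral_heatMajorant_le hq hn T hf hL hc.le)
    rw [lintegral_prod _ (hm1 b).aemeasurable,
      lintegral_prod _ ((measurable_heatMajorant hf c).pow_const q).aemeasurable]
    exact lintegral_congr fun t =>
      lintegral_add_right_eq_self (fun x => heatMajorant f c t x ^ q) (t • b)
  have h2 : ∀ b ∈ ballX T 0 1, ∫⁻ p : ℝ × E, 2 ^ q * (heatMajorant f c p.1 (p.2 + p.1 • b) ^ q +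
        scaledTaylorMajorant f c p.1 p.2 b ^ q) ∂(scaleMeasure q).prod volume ≤
      2 ^ q * (P + Q * ‖b‖ₑ ^ q) := by
    intro b hb
    rw [lintegral_const_mul' _ _ (by finiteness), lintegral_add_left (hm1 b)]
    gcongr
    · exact h1 b
    · exact lintegral_scaledTaylorMajorant_le hq T hf hL hc (by simpa [ballX] using hb)
  have h3 : ∀ {F G : E → ℝ≥0∞}, (∀ b ∈ ballX T 0 1, F b ≤ G b) →
      ⨍⁻ b, F b ∂(volume.restrict (ballX T 0 1)) ≤ ⨍⁻ b, G b ∂(volume.restrict (ballX T 0 1)) := by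
    intro F G h
    rw [setLAverage_eq, setLAverage_eq]
    exact ENNReal.div_le_div_right
      (setLIntegral_mono' (isClosed_ballX T 0 1).measurableSet h) _
  refine (h3 h2).trans (le_of_eq ?_)
  rw [setLAverage_eq, lintegral_const_mul' _ _ (by finiteness), lintegral_add_left (by fun_prop),
    setLIntegral_const, lintegral_const_mul _ (by fun_prop), mul_div_assoc, ENNReal.add_div,
    mul_div_assoc, ENNReal.div_self (volume_ballX_unit_ne_zero T) (volume_ballX_unit_ne_top T),
    mul_div_assoc, ← setLAverage_eq, laverage_enorm_rpow_ballX T hq0, hP, hQ,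
    ENNReal.ofReal_mul (by positivity : 0 ≤ c⁻¹)]
  simp_rw [ENNReal.mul_rpow_of_nonneg _ _ hq0.le]
  ring

/-- With `c = √(2γ)` and `W = n ^ (1/4) √(I_q M)`, the two quantities are exactly `√2 W` and `W /
√2`; the stated constants are rounded up. -/
theorem sqrt_gammaX_mul_le (hq : 0 < q) (hn : 1 ≤ n) (T : E ≃ₗ[ℝ] X) :
    √(2 * gammaX q T) * (meanNorm T * √n) ≤
      2 * ((n : ℝ) ^ (1 / 4 : ℝ) * √(meanRadius q T * meanNorm T)) ∧
    (√(2 * gammaX q T))⁻¹ * meanRadius q T ≤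
      (n : ℝ) ^ (1 / 4 : ℝ) * √(meanRadius q T * meanNorm T) := by
  have hI := meanRadius_pos T hn hq
  have hM := meanNorm_pos hn T
  have hn0 : (0 : ℝ) < n := by exact_mod_cast hn
  have hs : 0 < √(n : ℝ) := Real.sqrt_pos.2 hn0
  have hγ : 0 < gammaX q T := by rw [gammaX]; positivity
  set W := (n : ℝ) ^ (1 / 4 : ℝ) * √(meanRadius q T * meanNorm T) with hW
  have hW0 : 0 ≤ W := by positivity
  have hW2 : W ^ 2 = √n * (meanRadius q T * meanNorm T) := by
    rw [hW, mul_pow, Real.sq_sqrt (by positivity), ← Real.rpow_natCast, ← Real.rpow_mul hn0.le,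
      Real.sqrt_eq_rpow]
    norm_num
  have hc2 : √(2 * gammaX q T) ^ 2 = 2 * gammaX q T := Real.sq_sqrt (by positivity)
  constructor
  · refine le_of_sq_le_sq ?_ (by positivity)
    rw [mul_pow, hc2, mul_pow 2 W, hW2, gammaX]
    have : 2 * (meanRadius q T / (√n * meanNorm T)) * (meanNorm T * √n) ^ 2 =
        2 * (√n * (meanRadius q T * meanNorm T)) := by field_simp
    rw [this]
    nlinarith [mul_pos hs (mul_pos hI hM)]
  · refine le_of_sq_le_sq ?_ hW0
    rw [mul_pow, inv_pow, hc2, hW2, gammaX]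
    have : (2 * (meanRadius q T / (√n * meanNorm T)))⁻¹ * meanRadius q T ^ 2 =
        (√n * (meanRadius q T * meanNorm T)) / 2 := by field_simp
    rw [this]
    nlinarith [mul_pos hs (mul_pos hI hM)]

end final

theorem theorem1p6 :
    ∃ κ : ℝ, 2 ≤ κ ∧
      ∀ (q : ℝ) (_ : 2 ≤ q) (n : ℕ) (_ : 1 ≤ n)
        (X : Type*) [NormedAddCommGroup X] [NormedSpace ℝ X] (_ : Module.finrank ℝ X = n)
        (Y : Type*) [NormedAddCommGroup Y] [NormedSpace ℝ Y] [CompleteSpace Y]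
        (_ : martingaleCotype q Y < ∞)
        (N : X → ℝ) (_ : IsHilbertianNorm N)
        (T : EuclideanSpace ℝ (Fin n) ≃ₗ[ℝ] X) (_ : ∀ v, N (T v) = ‖v‖)
        (γ K : ℝ) (_ : γ = gammaX q T)
        (_ : K = κ * (n : ℝ) ^ (1 / 4 : ℝ) * (martingaleCotype q Y).toReal *
          Real.sqrt (meanRadius q T * meanNorm T))
        (f : EuclideanSpace ℝ (Fin n) → Y) (_ : HasCompactSupport f) (_ : lipNorm T f < ∞),
        (∫⁻ x, ∫⁻ t in Ioi (0 : ℝ), ⨍⁻ y,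
            ‖f y - taylorOne (heat (γ * t ^ 2) f) x y‖ₑ ^ q / ENNReal.ofReal (t ^ (q + 1))
              ∂(volume.restrict (ballX T x t))) ^ (1 / q)
          ≤ ENNReal.ofReal K * volume (tsupport f) ^ (1 / q) * lipNorm T f := by
  have hmom : gaussianMoment ≠ ∞ := lintegral_sq_add_one_mul_gaussianReal_lt_top.ne
  -- The 8 is `2 · 4`: 2 from splitting the `q`-th power of a sum, 4 from the one-dimensional
  -- inequality. The terms `2` and `gaussianMoment` come from the heat error and the Taylor
  -- remainder.
  refine ⟨8 * (2 + gaussianMoment.toReal), by linarith [gaussianMoment.toReal_nonneg], ?_⟩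
  rintro q hq n hn X _ _ - Y _ _ _ hm - - T - γ K rfl rfl f hs hL
  have hq0 : 0 < q := by linarith
  have hγ : 0 < gammaX q T := by
    have hI := meanRadius_pos T hn hq0
    have hM := meanNorm_pos hn T
    have hn0 : (0 : ℝ) < n := by exact_mod_cast hn
    rw [gammaX]
    positivity
  obtain ⟨hb1, hb2⟩ := sqrt_gammaX_mul_le hq0 hn T
  set W := (n : ℝ) ^ (1 / 4 : ℝ) * √(meanRadius q T * meanNorm T) with hW
  have hW0 : 0 ≤ W := by positivity
  have hsum : ENNReal.ofReal (√(2 * gammaX q T) * (meanNorm T * √n)) ^ q +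
      (gaussianMoment * ENNReal.ofReal ((√(2 * gammaX q T))⁻¹ * meanRadius q T)) ^ q ≤
      ((2 + gaussianMoment) * ENNReal.ofReal W) ^ q := by
    have e1 : ENNReal.ofReal (√(2 * gammaX q T) * (meanNorm T * √n)) ≤ 2 * ENNReal.ofReal W := by
      rw [← ENNReal.ofReal_ofNat 2, ← ENNReal.ofReal_mul zero_le_two]
      exact ENNReal.ofReal_le_ofReal hb1
    have e2 := ENNReal.ofReal_le_ofReal hb2
    calc _ ≤ (2 * ENNReal.ofReal W) ^ q + (gaussianMoment * ENNReal.ofReal W) ^ q := by gcongr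
      _ ≤ (2 * ENNReal.ofReal W + gaussianMoment * ENNReal.ofReal W) ^ q :=
        ENNReal.add_rpow_le_rpow_add _ _ (by linarith)
      _ = _ := by rw [add_mul]
  have hK : ENNReal.ofReal (8 * (2 + gaussianMoment.toReal) * (n : ℝ) ^ (1 / 4 : ℝ) *
      (martingaleCotype q Y).toReal * √(meanRadius q T * meanNorm T)) =
      2 * 4 * martingaleCotype q Y * ((2 + gaussianMoment) * ENNReal.ofReal W) := by
    have h0 := gaussianMoment.toReal_nonneg
    have : 8 * (2 + gaussianMoment.toReal) * (n : ℝ) ^ (1 / 4 : ℝ) *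
        (martingaleCotype q Y).toReal * √(meanRadius q T * meanNorm T) =
        8 * (martingaleCotype q Y).toReal * ((2 + gaussianMoment.toReal) * W) := by
      rw [hW]
      ring
    rw [this, ENNReal.ofReal_mul (by positivity), ENNReal.ofReal_mul (by positivity),
      ENNReal.ofReal_mul (by positivity), ENNReal.ofReal_add zero_le_two h0,
      ENNReal.ofReal_toReal hm.ne, ENNReal.ofReal_toReal hmom]
    norm_num
  rw [one_div]
  refine (ENNReal.rpow_inv_le_iff hq0).2 ?_
  refine (lintegral_taylor_error_le (by linarith) hn T hL hs hγ).trans ?_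
  refine (mul_le_mul_right hsum _).trans (le_of_eq ?_)
  rw [hK]
  simp_rw [ENNReal.mul_rpow_of_nonneg _ _ hq0.le]
  rw [← ENNReal.rpow_mul, inv_mul_cancel₀ hq0.ne', ENNReal.rpow_one]
  ring
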